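/- Throughout, $\|\cdot\|$ is the $\infty$-norm of vectors and the induced matrix norm, $\|\cdot\|_2$ the Euclidean (operator) norm, $A^\dagger=(A^\top A)^{-1}A^\top$ for a matrix $A$ of full column rank, and $\lambda_{\min},\lambda_{\max}$ are extreme eigenvalues of symmetric matrices. **Plant.** $\dot x=A_mx+B_m(\omega u+f(x,t))$, $y=C_mx$, $x(0)=x_0$, with $x\in\mathbb R^n$, $u\in\mathbb R^m$, $y\in\mathbb R^p$, unknown constant $\omega\in[\omega_l,\omega_u]$, where $0<\omega_l<\omega_u$ and $1\in[\omega_l,\omega_u]$, and unknown $f$ such that for all $t\ge0$: $\|f(0,t)\|<b_0$, and, for every $\delta>0$, $f$ has partial derivatives with $\|\partial f/\partial x\|\le d_\delta$, $\|\partial f/\partial t\|\le b_\delta$ whenever $\|x\|<\delta$ (with known constants $b_0,d_\delta,b_\delta>0$). **Interactor.** $Z(s)=C_z(sI-A_z)^{-1}B_z+D_z$ with $A_z\in\mathbb R^{n_z\times n_z}$ Hurwitz and $\begin{bmatrix}A_z-sI&B_z\\C_z&D_z\end{bmatrix}$ nonsingular for all $s\in\mathbb C$; $T_z\in\mathbb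 R^{n\times n_z}$ has full column rank, $\bar B\in\mathbb R^{n\times m}$, $C_m\bar B$ has full column rank, and $A_mT_z=T_zA_z+\bar BC_z$, $C_mA_mT_z=C_m\bar BC_z$, $B_m=T_zB_z+\bar BD_z$, $C_mB_m=C_m\bar BD_z$. **Design.** $H=\bar B(C_m\bar B)^\dagger$, $A_v=(I-HC_m)A_m+K_vC_m$, $P_y,P_v,Q$ symmetric positive definite with $A_v^\top P_v+P_vA_v=-Q$, $0<\epsilon_q<\lambda_{\min}(Q)$, $Q_v=Q-\epsilon_qI$, $\bar P_v=(I-HC_m)^\top P_v(I-HC_m)$, and $\sqrt{P_y}$ the upper triangular factor in $P_y=\sqrt{P_y}^\top\sqrt{P_y}$. Let $\rho_x,\rho_u>0$, $T_g(\omega)=[I_n,\ \omega T_z]$, $T(s)=T_z(sI-A_z)^{-1}B_z$, $$\bar d=\max_{\omega\in[\omega_l,\omega_u]}\big(\|C_zT_z^\dagger T_g(\omega)\|+\|D_z\|\|T_g(\omega)\|d_{\rho_x}\big),$$ $$\bar b=\|C_zT_z^\dagger\|\rho_x+\|D_z\|\|T\|_{\mathcal L_1}d_{\rho_x}^2\rho_x+\|D_z\|(\|T\|_{\mathcal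 L_1}d_{\rho_x}+1)b_0,$$ and let $\alpha$ be such that $\alpha_y=2\alpha-\frac{m\bar d^2}{\epsilon_q}\|\sqrt{P_y}C_m\bar B\|_2^2>0$. **Controller.** With $\dot x_u=A_zx_u+B_zu$, $x_u(0)=0$, $u_z=C_zx_u+D_zu$, $\hat x_v=\hat v+Hy$, $\hat x_g=(\hat x_v,x_u)$, $\tilde y=\hat y-y$, $e_y=\bar B^\top C_m^\top P_y\tilde y$ and $\hat\eta=\hat\omega u_z+\hat\theta\|\hat x_g\|+\hat\sigma$, the predictor is $$\dot{\hat v}=A_v\hat x_v-K_vy-P_v^{-1}A_m^\top C_m^\top P_y\tilde y,\quad \dot{\hat y}=-\alpha\tilde y+C_mA_m\hat x_v+C_m\bar B\hat\eta,\quad \hat v(0)=0,\ \hat y(0)=C_mx_0,$$ the adaptive laws are $$\dot{\hat\omega}=\Gamma_\omega\mathrm{Proj}(\hat\omega,-u_z^\top e_y),\quad\dot{\hat\theta}=\Gamma_\theta\mathrm{Proj}(\hat\theta,-\|\hat x_g\|e_y),\quad\dot{\hat\sigma}=\Gamma_\sigma\mathrm{Proj}(\hat\sigma,-e_y),$$ with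 $\hat\omega(0)=1$, $\hat\theta(0)=\hat\sigma(0)=0$ and gains $\Gamma_\omega,\Gamma_\theta,\Gamma_\sigma>0$, and the control law is $u(s)=-D(s)Z^{-1}(s)(\hat\eta(s)-Z(s)K_gr(s))$ with $D(s)Z^{-1}(s)$ rational and strictly proper and $r$ a bounded measurable reference. $\mathrm{Proj}$ is the smooth projection operator with tolerance $\varepsilon>0$ for, respectively, the interval $[\omega_l,\omega_u]$ and the Euclidean balls about $0$ of radii $\sqrt m\,\bar d$ and $\sqrt m\,\bar b$: for the ball with centre $c$ and radius $R$, with $g(\theta)=(\|\theta-c\|_2^2-R^2)/(\varepsilon R^2)$, $\mathrm{Proj}(\theta,z)=z-g(\theta)\frac{\langle\theta-c,z\rangle}{\|\theta-c\|_2^2}(\theta-c)$ if $g(\theta)\ge0$ and $\langle\theta-c,z\rangle>0$, and $\mathrm{Proj}(\theta,z)=z$ otherwise. **Virtual system.** $\dot x_f=A_zx_f+B_zf(T_gx_g+T_zx_f,t)$, $x_f(0)=0$, and $\dot x_v=A_mx_v+\bar B(\omega u_z+\bar f)$, $x_v(0)=x_0$, where $x_g=(x_v,x_u)$ and $\bar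 f=C_zx_f+D_zf(T_gx_g+T_zx_f,t)$. Say that $(\bar l_\theta,\bar l_\sigma)$ are *rate bounds* for a closed-loop solution on $[0,\tau]$ if the virtual system has a solution on $[0,\tau]$ with $\bar f=\theta(t)\|x_g(t)\|+\sigma(t)$, $\|\theta(t)\|\le\bar d$, $\|\sigma(t)\|\le\bar b$ for $t\in[0,\tau]$, and $\theta,\sigma$ Lipschitz on $[0,\tau]$ with constants $\bar l_\theta,\bar l_\sigma$ (that is, $\|\dot\theta\|\le\bar l_\theta$, $\|\dot\sigma\|\le\bar l_\sigma$ almost everywhere). **Lemma 5.** Consider closed-loop solutions on $[0,\tau]$, $\tau>0$, with $\|x(t)\|\le\rho_x$ and $\|u(t)\|\le\rho_u$ for all $t\in[0,\tau]$. (i) There are $\bar l_\theta,\bar l_\sigma\ge0$, depending only on the plant, interactor and design data (not on $\omega$, $f$, $x_0$, $D$, $K_g$, $r$, the gains, $\varepsilon$ or $\tau$), which are rate bounds for every such solution. (ii) For all $\bar l_\theta,\bar l_\sigma\ge0$ there is $\varepsilon_0>0$, depending only on these two numbers and the same data, such that if $0<\varepsilon\le\varepsilon_0$, then for every such solution for which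 $(\bar l_\theta,\bar l_\sigma)$ are rate bounds, and all $t\in[0,\tau]$, $$\|\tilde y(t)\|\le\kappa_ye^{-\frac{\lambda_1}2t}\|x_0\|+\sqrt{\frac{\theta_1}{\lambda_{\min}(P_y)}}\,\frac1{\sqrt\Gamma},$$ where $\kappa_y=\sqrt{n\,\lambda_{\max}(\bar P_v)/\lambda_{\min}(P_y)}$, $\lambda_1=\min\big(\lambda_{\min}(Q_v)/\lambda_{\max}(P_v),\alpha_y\big)$, $\theta_1=4(\omega_u^2+m\bar d^2+m\bar b^2)+4m(\bar d\,\bar l_\theta+\bar b\,\bar l_\sigma)/\lambda_1$ and $\Gamma=\min(\Gamma_\omega,\Gamma_\theta,\Gamma_\sigma)$. -/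

import Mathlib

open Matrix Set

namespace L1Adaptive

noncomputable section

/-! ### Matrix and system-theoretic notions -/

/-- All (complex) eigenvalues of the real matrix `A` lie in the open left half-plane. -/
def IsHurwitz {k : ℕ} (A : Matrix (Fin k) (Fin k) ℝ) : Prop :=
  ∀ μ ∈ spectrum ℂ (A.map (algebraMap ℝ ℂ)), μ.re < 0

/-- The matrix norm induced by the vector `∞`-norm (maximal absolute row sum). -/
def infNorm {ι κ : Type} [Fintype ι] [Fintype κ] (A : Matrix ι κ ℝ) : ℝ :=
  letI : NormedAddCommGroup (Matrix ι κ ℝ) := Matrix.linftyOpNormedAddCommGroup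
  ‖A‖

/-- The matrix norm induced by the Euclidean vector norms (largest singular value). -/
def twoNorm {k l : ℕ} (A : Matrix (Fin k) (Fin l) ℝ) : ℝ :=
  letI : NormedAddCommGroup (Matrix (Fin k) (Fin l) ℝ) := Matrix.instL2OpNormedAddCommGroup
  ‖A‖

/-- The generalized (Moore-Penrose) left inverse `(AᵀA)⁻¹Aᵀ` of a matrix of full column rank. -/
def leftInv {k l : ℕ} (A : Matrix (Fin k) (Fin l) ℝ) : Matrix (Fin l) (Fin k) ℝ :=
  (Aᵀ * A)⁻¹ * Aᵀ

/-- Smallest eigenvalue of a real symmetric matrix. -/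
def lambdaMin {k : ℕ} (A : Matrix (Fin k) (Fin k) ℝ) : ℝ := sInf (spectrum ℝ A)

/-- Largest eigenvalue of a real symmetric matrix. -/
def lambdaMax {k : ℕ} (A : Matrix (Fin k) (Fin k) ℝ) : ℝ := sSup (spectrum ℝ A)

/-- The transfer matrix `C (s I - A)⁻¹ B + D`, with entries in the field `ℝ(s)`. -/
def transfer {k l q : ℕ} (A : Matrix (Fin k) (Fin k) ℝ) (B : Matrix (Fin k) (Fin l) ℝ)
    (C : Matrix (Fin q) (Fin k) ℝ) (D : Matrix (Fin q) (Fin l) ℝ) :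
    Matrix (Fin q) (Fin l) (RatFunc ℝ) :=
  C.map RatFunc.C *
      ((RatFunc.X : RatFunc ℝ) • (1 : Matrix (Fin k) (Fin k) (RatFunc ℝ)) - A.map RatFunc.C)⁻¹ *
    B.map RatFunc.C + D.map RatFunc.C

/-- The `𝓛₁` norm `max_i ∑_j ∫_0^∞ |h_{ij}(t)| dt` of the strictly proper transfer matrix
`C (s I - A)⁻¹ B`, whose impulse response is `h(t) = C e^{At} B`. -/
def l1Norm {k l q : ℕ} (A : Matrix (Fin k) (Fin k) ℝ) (B : Matrix (Fin k) (Fin l) ℝ)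
    (C : Matrix (Fin q) (Fin k) ℝ) : ℝ :=
  ⨆ i : Fin q, ∑ j : Fin l, ∫ t in Ioi (0 : ℝ), |(C * NormedSpace.exp (t • A) * B) i j|

/-- The smooth (Pomet-Praly) projection operator for the ball with centre `c` and radius `R`, with
boundary layer of relative width `ε`. With `g(θ) = (‖θ - c‖² - R²) / (ε R²)`,
`Proj(θ, y) = y - g(θ) ⟨∇g, y⟩ ∇g / ‖∇g‖²` if `g(θ) ≥ 0` and `⟨∇g, y⟩ > 0`, and
`Proj(θ, y) = y` otherwise (`∇g` is a positive multiple of `θ - c`). -/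
def smoothProj {E : Type} [NormedAddCommGroup E] [InnerProductSpace ℝ E]
    (ε : ℝ) (c : E) (R : ℝ) (θ y : E) : E :=
  open Classical in
  if 0 ≤ (‖θ - c‖ ^ 2 - R ^ 2) / (ε * R ^ 2) ∧ 0 < inner ℝ (θ - c) y then
    y - ((‖θ - c‖ ^ 2 - R ^ 2) / (ε * R ^ 2) * inner ℝ (θ - c) y / ‖θ - c‖ ^ 2) • (θ - c)
  else y

/-- The smooth projection operator on `ℝᵏ` for the Euclidean ball of radius `R` about `0`. -/
def vecProj {k : ℕ} (ε R : ℝ) (θ y : Fin k → ℝ) : Fin k → ℝ :=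
  (smoothProj ε (0 : EuclideanSpace ℝ (Fin k)) R (WithLp.toLp 2 θ) (WithLp.toLp 2 y)).ofLp

/-! ### Design data -/

/-- The known data: the desired dynamics, the interactor, the predictor design and the a priori
bounds on the uncertainties. -/
structure Design (n m p nz : ℕ) where
  Am : Matrix (Fin n) (Fin n) ℝ
  Bm : Matrix (Fin n) (Fin m) ℝ
  Cm : Matrix (Fin p) (Fin n) ℝ
  Az : Matrix (Fin nz) (Fin nz) ℝ
  Bz : Matrix (Fin nz) (Fin m) ℝ
  Cz : Matrix (Fin m) (Fin nz) ℝ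
  Dz : Matrix (Fin m) (Fin m) ℝ
  Tz : Matrix (Fin n) (Fin nz) ℝ
  Bbar : Matrix (Fin n) (Fin m) ℝ
  Kv : Matrix (Fin n) (Fin p) ℝ
  Py : Matrix (Fin p) (Fin p) ℝ
  /-- Cholesky factor of `Py`. -/
  sqrtPy : Matrix (Fin p) (Fin p) ℝ
  Pv : Matrix (Fin n) (Fin n) ℝ
  Q : Matrix (Fin n) (Fin n) ℝ
  εq : ℝ
  α : ℝ
  ωl : ℝ
  ωu : ℝ
  /-- Bound on `‖f(0, t)‖`. -/
  b₀ : ℝ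
  /-- `d δ` bounds `‖∂f/∂x‖` on `‖x‖ < δ`. -/
  d : ℝ → ℝ
  /-- `b δ` bounds `‖∂f/∂t‖` on `‖x‖ < δ`. -/
  b : ℝ → ℝ
  ρx : ℝ
  ρu : ℝ

namespace Design

variable {n m p nz : ℕ} (S : Design n m p nz)

def H : Matrix (Fin n) (Fin p) ℝ := S.Bbar * leftInv (S.Cm * S.Bbar)

def AH : Matrix (Fin n) (Fin n) ℝ := (1 - S.H * S.Cm) * S.Am

def Av : Matrix (Fin n) (Fin n) ℝ := S.AH + S.Kv * S.Cm

def PvBar : Matrix (Fin n) (Fin n) ℝ := (1 - S.H * S.Cm)ᵀ * S.Pv * (1 - S.H * S.Cm)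

def Qv : Matrix (Fin n) (Fin n) ℝ := S.Q - S.εq • 1

/-- `T_g = [I, ω T_z]`. -/
def Tg (ω : ℝ) : Matrix (Fin n) (Fin n ⊕ Fin nz) ℝ := Matrix.fromCols 1 (ω • S.Tz)

/-- The bound on `θ`. -/
def dBar : ℝ :=
  sSup ((fun ω : ℝ => infNorm (S.Cz * leftInv S.Tz * S.Tg ω) +
    infNorm S.Dz * infNorm (S.Tg ω) * S.d S.ρx) '' Icc S.ωl S.ωu)

/-- The bound on `σ`. -/
def bBar : ℝ :=
  infNorm (S.Cz * leftInv S.Tz) * S.ρx +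
    infNorm S.Dz * l1Norm S.Az S.Bz S.Tz * S.d S.ρx ^ 2 * S.ρx +
    infNorm S.Dz * (l1Norm S.Az S.Bz S.Tz * S.d S.ρx + 1) * S.b₀

def αφ : ℝ := m * S.dBar ^ 2 / S.εq * twoNorm (S.sqrtPy * S.Cm * S.Bbar) ^ 2

def αy : ℝ := 2 * S.α - S.αφ

def κy : ℝ := √(n * (lambdaMax S.PvBar / lambdaMin S.Py))

def lam₁ : ℝ := min (lambdaMin S.Qv / lambdaMax S.Pv) S.αy

def θ₀ : ℝ := 4 * (S.ωu ^ 2 + m * S.dBar ^ 2 + m * S.bBar ^ 2)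

def θ₁ (lθ lσ : ℝ) : ℝ := S.θ₀ + 4 * m * ((S.dBar * lθ + S.bBar * lσ) / S.lam₁)

/-- The constraints on the design data. (That `Av` is Hurwitz follows from `lyapunov`.) -/
structure Admissible : Prop where
  Az_hurwitz : IsHurwitz S.Az
  pencil : ∀ s : ℂ, (Matrix.fromBlocks
    (S.Az.map (algebraMap ℝ ℂ) - s • (1 : Matrix (Fin nz) (Fin nz) ℂ))
    (S.Bz.map (algebraMap ℝ ℂ)) (S.Cz.map (algebraMap ℝ ℂ)) (S.Dz.map (algebraMap ℝ ℂ))).det ≠ 0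
  AmTz : S.Am * S.Tz = S.Tz * S.Az + S.Bbar * S.Cz
  CmAmTz : S.Cm * S.Am * S.Tz = S.Cm * S.Bbar * S.Cz
  Bm_eq : S.Bm = S.Tz * S.Bz + S.Bbar * S.Dz
  CmBm : S.Cm * S.Bm = S.Cm * S.Bbar * S.Dz
  rank_Tz : S.Tz.rank = nz
  rank_CmBbar : (S.Cm * S.Bbar).rank = m
  Py_pos : S.Py.PosDef
  Pv_pos : S.Pv.PosDef
  Q_pos : S.Q.PosDef
  lyapunov : S.Avᵀ * S.Pv + S.Pv * S.Av = -S.Q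
  εq_pos : 0 < S.εq
  εq_lt : S.εq < lambdaMin S.Q
  sqrtPy_upper : S.sqrtPy.BlockTriangular id
  sqrtPy_sq : S.sqrtPyᵀ * S.sqrtPy = S.Py
  αy_pos : 0 < S.αy
  ωl_pos : 0 < S.ωl
  ωl_lt : S.ωl < S.ωu
  /-- The initial value `1` of the estimate of the input gain is an admissible gain. -/
  one_mem : (1 : ℝ) ∈ Icc S.ωl S.ωu
  b₀_pos : 0 < S.b₀
  d_pos : ∀ δ > 0, 0 < S.d δ
  b_pos : ∀ δ > 0, 0 < S.b δ
  ρx_pos : 0 < S.ρx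
  ρu_pos : 0 < S.ρu

end Design

/-! ### Unknowns, controller, signals -/

/-- The unknown input gain, matched uncertainty and initial state. -/
structure Unknowns (n m : ℕ) where
  ω : ℝ
  f : (Fin n → ℝ) → ℝ → (Fin m → ℝ)
  x₀ : Fin n → ℝ

/-- The assumptions on the unknowns. The operator norm of the Fréchet derivative with respect to
the sup norms is the matrix `∞`-norm of the Jacobian. -/
structure Unknowns.Admissible {n m p nz : ℕ} (W : Unknowns n m) (S : Design n m p nz) : Prop where
  ω_mem : W.ω ∈ Icc S.ωl S.ωu
  f_zero : ∀ t ≥ 0, ‖W.f 0 t‖ < S.b₀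
  f_dx : ∀ δ > 0, ∀ x : Fin n → ℝ, ‖x‖ < δ → ∀ t ≥ 0,
    DifferentiableAt ℝ (fun z => W.f z t) x ∧ ‖fderiv ℝ (fun z => W.f z t) x‖ ≤ S.d δ
  f_dt : ∀ δ > 0, ∀ x : Fin n → ℝ, ‖x‖ < δ → ∀ t ≥ 0,
    DifferentiableWithinAt ℝ (W.f x) (Ici 0) t ∧ ‖derivWithin (W.f x) (Ici 0) t‖ ≤ S.b δ

/-- Controller data: the filter `D(s)`, a state-space realization `(Ad, Bd, Cd)` of
`D(s) Z⁻¹(s)`, the feed-forward gain and the reference, the adaptation gains, and the tolerance of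
the projection operators. -/
structure Controller (m mr nd : ℕ) where
  D : Matrix (Fin m) (Fin m) (RatFunc ℝ)
  Ad : Matrix (Fin nd) (Fin nd) ℝ
  Bd : Matrix (Fin nd) (Fin m) ℝ
  Cd : Matrix (Fin m) (Fin nd) ℝ
  Kg : Matrix (Fin m) (Fin mr) ℝ
  r : ℝ → Fin mr → ℝ
  Γω : ℝ
  Γθ : ℝ
  Γσ : ℝ
  ε : ℝ

/-- `Γ`, the smallest adaptation gain. -/
def Controller.Γ {m mr nd : ℕ} (K : Controller m mr nd) : ℝ := min K.Γω (min K.Γθ K.Γσ)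

structure Controller.Admissible {n m p nz mr nd : ℕ} (K : Controller m mr nd)
    (S : Design n m p nz) : Prop where
  realization : transfer K.Ad K.Bd K.Cd 0 = K.D * (transfer S.Az S.Bz S.Cz S.Dz)⁻¹
  r_meas : Measurable K.r
  r_bdd : ∃ R : ℝ, ∀ t ≥ 0, ‖K.r t‖ ≤ R
  Γω_pos : 0 < K.Γω
  Γθ_pos : 0 < K.Γθ
  Γσ_pos : 0 < K.Γσ
  ε_pos : 0 < K.ε

/-- The signals of the closed loop: plant state `x`, input `u`, input-filter state `xu`, predictor
states `vHat`, `yHat`, adaptive estimates, and the states `xd`, `xr` of the control filter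
`D(s) Z⁻¹(s)` and of the reference filter `Z(s)`. -/
structure Signals (n m p nz nd : ℕ) where
  x : ℝ → Fin n → ℝ
  u : ℝ → Fin m → ℝ
  xu : ℝ → Fin nz → ℝ
  vHat : ℝ → Fin n → ℝ
  yHat : ℝ → Fin p → ℝ
  ωHat : ℝ → ℝ
  θHat : ℝ → Fin m → ℝ
  σHat : ℝ → Fin m → ℝ
  xd : ℝ → Fin nd → ℝ
  xr : ℝ → Fin nz → ℝ

namespace Signals

variable {n m p nz mr nd : ℕ} (s : Signals n m p nz nd) (S : Design n m p nz)

/-- The measured output. -/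
def y (t : ℝ) : Fin p → ℝ := S.Cm *ᵥ s.x t

/-- The output-estimation error. -/
def yTilde (t : ℝ) : Fin p → ℝ := s.yHat t - s.y S t

def uz (t : ℝ) : Fin m → ℝ := S.Cz *ᵥ s.xu t + S.Dz *ᵥ s.u t

def xvHat (t : ℝ) : Fin n → ℝ := s.vHat t + S.H *ᵥ s.y S t

def xgHat (t : ℝ) : Fin n ⊕ Fin nz → ℝ := Sum.elim (s.xvHat S t) (s.xu t)

def ηHat (t : ℝ) : Fin m → ℝ :=
  s.ωHat t • s.uz S t + ‖s.xgHat S t‖ • s.θHat t + s.σHat t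

def ey (t : ℝ) : Fin m → ℝ := (S.Bbarᵀ * S.Cmᵀ * S.Py) *ᵥ s.yTilde S t

/-- The filtered reference `r_z(s) = Z(s) K_g r(s)`. -/
def rz (K : Controller m mr nd) (t : ℝ) : Fin m → ℝ := S.Cz *ᵥ s.xr t + S.Dz *ᵥ K.Kg *ᵥ K.r t

/-- The signals solve the closed-loop equations on `[0, τ]`. The two filters driven by the
reference, which need not be continuous, are solved in integrated form; all other equations
hold pointwise. -/
structure IsClosedLoop (W : Unknowns n m) (K : Controller m mr nd) (τ : ℝ) : Prop where
  x_zero : s.x 0 = W.x₀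
  x_ode : ∀ t ∈ Icc 0 τ, HasDerivWithinAt s.x
    (S.Am *ᵥ s.x t + S.Bm *ᵥ (W.ω • s.u t + W.f (s.x t) t)) (Icc 0 τ) t
  xu_zero : s.xu 0 = 0
  xu_ode : ∀ t ∈ Icc 0 τ, HasDerivWithinAt s.xu (S.Az *ᵥ s.xu t + S.Bz *ᵥ s.u t) (Icc 0 τ) t
  xr_cont : ContinuousOn s.xr (Icc 0 τ)
  xr_eq : ∀ t ∈ Icc 0 τ, s.xr t = ∫ q in (0 : ℝ)..t, (S.Az *ᵥ s.xr q + S.Bz *ᵥ K.Kg *ᵥ K.r q)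
  xd_cont : ContinuousOn s.xd (Icc 0 τ)
  xd_eq : ∀ t ∈ Icc 0 τ, s.xd t =
    ∫ q in (0 : ℝ)..t, (K.Ad *ᵥ s.xd q + K.Bd *ᵥ (s.ηHat S q - s.rz S K q))
  u_eq : ∀ t ∈ Icc 0 τ, s.u t = -(K.Cd *ᵥ s.xd t)
  vHat_zero : s.vHat 0 = 0
  vHat_ode : ∀ t ∈ Icc 0 τ, HasDerivWithinAt s.vHat
    (S.Av *ᵥ s.xvHat S t - S.Kv *ᵥ s.y S t - (S.Pv⁻¹ * S.Amᵀ * S.Cmᵀ * S.Py) *ᵥ s.yTilde S t)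
    (Icc 0 τ) t
  yHat_zero : s.yHat 0 = S.Cm *ᵥ W.x₀
  yHat_ode : ∀ t ∈ Icc 0 τ, HasDerivWithinAt s.yHat
    (-(S.α • s.yTilde S t) + (S.Cm * S.Am) *ᵥ s.xvHat S t + (S.Cm * S.Bbar) *ᵥ s.ηHat S t)
    (Icc 0 τ) t
  ωHat_zero : s.ωHat 0 = 1
  ωHat_ode : ∀ t ∈ Icc 0 τ, HasDerivWithinAt s.ωHat
    (K.Γω * smoothProj K.ε ((S.ωl + S.ωu) / 2) ((S.ωu - S.ωl) / 2) (s.ωHat t)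
      (-(s.uz S t ⬝ᵥ s.ey S t))) (Icc 0 τ) t
  θHat_zero : s.θHat 0 = 0
  θHat_ode : ∀ t ∈ Icc 0 τ, HasDerivWithinAt s.θHat
    (K.Γθ • vecProj K.ε (√m * S.dBar) (s.θHat t) (-(‖s.xgHat S t‖ • s.ey S t))) (Icc 0 τ) t
  σHat_zero : s.σHat 0 = 0
  σHat_ode : ∀ t ∈ Icc 0 τ, HasDerivWithinAt s.σHat
    (K.Γσ • vecProj K.ε (√m * S.bBar) (s.σHat t) (-(s.ey S t))) (Icc 0 τ) t

/-- State and input stay within `ρx` and `ρu` on `[0, τ]`. -/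
def Bounded (τ : ℝ) : Prop :=
  ∀ t ∈ Icc 0 τ, ‖s.x t‖ ≤ S.ρx ∧ ‖s.u t‖ ≤ S.ρu

/-- `x_g = (x_v, x_u)`. -/
def xg (xv : ℝ → Fin n → ℝ) (t : ℝ) : Fin n ⊕ Fin nz → ℝ := Sum.elim (xv t) (s.xu t)

/-- The matched uncertainty evaluated along the virtual system, `f(T_g x_g + T_z x_f, t)`. -/
def fv (W : Unknowns n m) (xv : ℝ → Fin n → ℝ) (xf : ℝ → Fin nz → ℝ) (t : ℝ) : Fin m → ℝ :=
  W.f (S.Tg W.ω *ᵥ s.xg xv t + S.Tz *ᵥ xf t) t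

/-- The lumped uncertainty `f̄(X, t)` of the virtual system. -/
def fBar (W : Unknowns n m) (xv : ℝ → Fin n → ℝ) (xf : ℝ → Fin nz → ℝ) (t : ℝ) : Fin m → ℝ :=
  S.Cz *ᵥ xf t + S.Dz *ᵥ s.fv S W xv xf t

/-- `(x_v, x_f)` solves the virtual system on `[0, τ]`. -/
structure IsVirtual (W : Unknowns n m) (τ : ℝ) (xv : ℝ → Fin n → ℝ) (xf : ℝ → Fin nz → ℝ) :
    Prop where
  xf_zero : xf 0 = 0
  xf_ode : ∀ t ∈ Icc 0 τ,
    HasDerivWithinAt xf (S.Az *ᵥ xf t + S.Bz *ᵥ s.fv S W xv xf t) (Icc 0 τ) t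
  xv_zero : xv 0 = W.x₀
  xv_ode : ∀ t ∈ Icc 0 τ, HasDerivWithinAt xv
    (S.Am *ᵥ xv t + S.Bbar *ᵥ (W.ω • s.uz S t + s.fBar S W xv xf t)) (Icc 0 τ) t

/-- The lumped uncertainty of the virtual system is `θ(t) ‖x_g(t)‖ + σ(t)` on `[0, τ]`, where
`θ` and `σ` are bounded by `dBar` and `bBar` and have rates of change bounded by `lθ` and `lσ`.
The rate bounds are Lipschitz bounds: for (piecewise) differentiable functions these are bounds
on the derivatives, and in general bounds on the derivatives almost everywhere. -/
def Parametrized (W : Unknowns n m) (τ lθ lσ : ℝ) : Prop :=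
  ∃ (xv : ℝ → Fin n → ℝ) (xf : ℝ → Fin nz → ℝ) (θ σ : ℝ → Fin m → ℝ),
    s.IsVirtual S W τ xv xf ∧
    (∀ t ∈ Icc 0 τ, s.fBar S W xv xf t = ‖s.xg xv t‖ • θ t + σ t) ∧
    (∀ t ∈ Icc 0 τ, ‖θ t‖ ≤ S.dBar ∧ ‖σ t‖ ≤ S.bBar) ∧
    (∀ t ∈ Icc 0 τ, ∀ t' ∈ Icc 0 τ,
      ‖θ t - θ t'‖ ≤ lθ * |t - t'| ∧ ‖σ t - σ t'‖ ≤ lσ * |t - t'|)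

end Signals

end

end L1Adaptive

namespace L1Adaptive

/-! ### Matrix norms, extreme eigenvalues, left inverses -/

section Norms

variable {ι κ : Type} [Fintype ι] [Fintype κ]

theorem infNorm_nonneg (A : Matrix ι κ ℝ) : 0 ≤ infNorm A :=
  letI : NormedAddCommGroup (Matrix ι κ ℝ) := Matrix.linftyOpNormedAddCommGroup
  norm_nonneg A

theorem infNorm_pos {A : Matrix ι κ ℝ} (hA : A ≠ 0) : 0 < infNorm A :=
  letI : NormedAddCommGroup (Matrix ι κ ℝ) := Matrix.linftyOpNormedAddCommGroup
  norm_pos_iff.2 hA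

theorem norm_mulVec_le_infNorm (A : Matrix ι κ ℝ) (v : κ → ℝ) :
    ‖A *ᵥ v‖ ≤ infNorm A * ‖v‖ :=
  Matrix.linfty_opNorm_mulVec A v

theorem continuous_infNorm : Continuous (infNorm : Matrix ι κ ℝ → ℝ) :=
  letI : NormedAddCommGroup (Matrix ι κ ℝ) := Matrix.linftyOpNormedAddCommGroup
  continuous_norm

theorem dotProduct_self_eq_norm_sq (v : ι → ℝ) :
    v ⬝ᵥ v = ‖(WithLp.toLp 2 v : EuclideanSpace ℝ ι)‖ ^ 2 := by
  rw [EuclideanSpace.norm_sq_eq]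
  simp [dotProduct, sq]

theorem zero_le_dotProduct_self (v : ι → ℝ) : 0 ≤ v ⬝ᵥ v := by
  rw [dotProduct_self_eq_norm_sq]; positivity

theorem dotProduct_mulVec_self_le_twoNorm {k l : ℕ} (A : Matrix (Fin k) (Fin l) ℝ)
    (v : Fin l → ℝ) : (A *ᵥ v) ⬝ᵥ (A *ᵥ v) ≤ twoNorm A ^ 2 * (v ⬝ᵥ v) := by
  rw [dotProduct_self_eq_norm_sq, dotProduct_self_eq_norm_sq, ← mul_pow]
  exact pow_le_pow_left₀ (norm_nonneg _)
    (Matrix.l2_opNorm_mulVec A (WithLp.toLp 2 v : EuclideanSpace ℝ (Fin l))) 2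

theorem norm_sq_le_dotProduct_self (v : ι → ℝ) : ‖v‖ ^ 2 ≤ v ⬝ᵥ v := by
  have h : ‖v‖ ≤ √(v ⬝ᵥ v) := by
    refine (pi_norm_le_iff_of_nonneg (Real.sqrt_nonneg _)).2 fun i => ?_
    refine Real.le_sqrt_of_sq_le ?_
    rw [Real.norm_eq_abs, sq_abs, sq]
    exact Finset.single_le_sum (f := fun j => v j * v j) (fun j _ => mul_self_nonneg _)
      (Finset.mem_univ i)
  calc ‖v‖ ^ 2 ≤ √(v ⬝ᵥ v) ^ 2 := pow_le_pow_left₀ (norm_nonneg _) h 2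
    _ = v ⬝ᵥ v := Real.sq_sqrt (zero_le_dotProduct_self v)

theorem dotProduct_self_le_card_mul_norm_sq {k : ℕ} (v : Fin k → ℝ) :
    v ⬝ᵥ v ≤ k * ‖v‖ ^ 2 := by
  calc v ⬝ᵥ v ≤ ∑ _i : Fin k, ‖v‖ ^ 2 := by
        refine Finset.sum_le_sum fun i _ => ?_
        rw [← sq, ← sq_abs]
        exact pow_le_pow_left₀ (abs_nonneg _) (norm_le_pi_norm v i) 2
    _ = k * ‖v‖ ^ 2 := by simp

theorem abs_dotProduct_le_sqrt (v w : ι → ℝ) : |v ⬝ᵥ w| ≤ √(v ⬝ᵥ v) * √(w ⬝ᵥ w) := by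
  rw [dotProduct_self_eq_norm_sq, dotProduct_self_eq_norm_sq, Real.sqrt_sq (norm_nonneg _),
    Real.sqrt_sq (norm_nonneg _)]
  have := abs_real_inner_le_norm (WithLp.toLp 2 v : EuclideanSpace ℝ ι) (WithLp.toLp 2 w)
  rwa [EuclideanSpace.inner_eq_star_dotProduct, star_trivial, dotProduct_comm] at this

end Norms

section Eigenvalues

variable {k : ℕ} {A : Matrix (Fin k) (Fin k) ℝ}

theorem finite_spectrum_of_isHermitian (hA : A.IsHermitian) : (spectrum ℝ A).Finite := by
  rw [hA.spectrum_real_eq_range_eigenvalues]; exact finite_range _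

theorem nonempty_spectrum_of_isHermitian (hk : 0 < k) (hA : A.IsHermitian) :
    (spectrum ℝ A).Nonempty := by
  have : Nonempty (Fin k) := ⟨⟨0, hk⟩⟩
  rw [hA.spectrum_real_eq_range_eigenvalues]; exact range_nonempty _

theorem lambdaMin_mul_dotProduct_le (hA : A.IsHermitian) (v : Fin k → ℝ) :
    lambdaMin A * (v ⬝ᵥ v) ≤ v ⬝ᵥ (A *ᵥ v) := by
  have h : (A - algebraMap ℝ (Matrix (Fin k) (Fin k) ℝ) (lambdaMin A)).PosSemidef := by
    refine posSemidef_iff_isHermitian_and_spectrum_nonneg.2 ⟨?_, ?_⟩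
    · refine hA.sub ?_
      rw [Algebra.algebraMap_eq_smul_one]
      exact (isHermitian_one).smul (by simp [IsSelfAdjoint])
    · rw [← spectrum.sub_singleton_eq]
      rintro _ ⟨a, ha, b, rfl, rfl⟩
      exact sub_nonneg.2 (csInf_le (finite_spectrum_of_isHermitian hA).bddBelow ha)
  have := h.dotProduct_mulVec_nonneg v
  rw [star_trivial, sub_mulVec, dotProduct_sub, Algebra.algebraMap_eq_smul_one, smul_mulVec,
    one_mulVec, dotProduct_smul, smul_eq_mul] at this
  linarith

theorem dotProduct_le_lambdaMax_mul (hA : A.IsHermitian) (v : Fin k → ℝ) :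
    v ⬝ᵥ (A *ᵥ v) ≤ lambdaMax A * (v ⬝ᵥ v) := by
  have h : (algebraMap ℝ (Matrix (Fin k) (Fin k) ℝ) (lambdaMax A) - A).PosSemidef := by
    refine posSemidef_iff_isHermitian_and_spectrum_nonneg.2 ⟨?_, ?_⟩
    · refine IsHermitian.sub ?_ hA
      rw [Algebra.algebraMap_eq_smul_one]
      exact (isHermitian_one).smul (by simp [IsSelfAdjoint])
    · rw [← spectrum.singleton_sub_eq]
      rintro _ ⟨a, rfl, b, hb, rfl⟩
      exact sub_nonneg.2 (le_csSup (finite_spectrum_of_isHermitian hA).bddAbove hb)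
  have := h.dotProduct_mulVec_nonneg v
  rw [star_trivial, sub_mulVec, dotProduct_sub, Algebra.algebraMap_eq_smul_one, smul_mulVec,
    one_mulVec, dotProduct_smul, smul_eq_mul] at this
  linarith

theorem lambdaMin_pos (hk : 0 < k) (hA : A.PosDef) : 0 < lambdaMin A := by
  have hm := (nonempty_spectrum_of_isHermitian hk hA.isHermitian).csInf_mem
    (finite_spectrum_of_isHermitian hA.isHermitian)
  change lambdaMin A ∈ _ at hm
  rw [hA.isHermitian.spectrum_real_eq_range_eigenvalues] at hm
  obtain ⟨i, hi⟩ := hm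
  rw [← hi]; exact hA.eigenvalues_pos i

theorem lambdaMax_pos (hk : 0 < k) (hA : A.PosDef) : 0 < lambdaMax A := by
  have hm := (nonempty_spectrum_of_isHermitian hk hA.isHermitian).csSup_mem
    (finite_spectrum_of_isHermitian hA.isHermitian)
  change lambdaMax A ∈ _ at hm
  rw [hA.isHermitian.spectrum_real_eq_range_eigenvalues] at hm
  obtain ⟨i, hi⟩ := hm
  rw [← hi]; exact hA.eigenvalues_pos i

theorem lambdaMax_nonneg (hA : A.PosSemidef) : 0 ≤ lambdaMax A :=
  Real.sSup_nonneg fun _ ha => (posSemidef_iff_isHermitian_and_spectrum_nonneg.1 hA).2 ha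

theorem lambdaMin_sub_smul_one_pos (hk : 0 < k) (hA : A.IsHermitian) {c : ℝ}
    (hc : c < lambdaMin A) : 0 < lambdaMin (A - c • 1) := by
  have hB : (A - c • (1 : Matrix (Fin k) (Fin k) ℝ)).IsHermitian :=
    hA.sub ((isHermitian_one).smul (by simp [IsSelfAdjoint]))
  have hm := (nonempty_spectrum_of_isHermitian hk hB).csInf_mem
    (finite_spectrum_of_isHermitian hB)
  change lambdaMin _ ∈ _ at hm
  rw [← Algebra.algebraMap_eq_smul_one, ← spectrum.sub_singleton_eq] at hm
  obtain ⟨a, ha, b, rfl, hab⟩ := hm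
  rw [← Algebra.algebraMap_eq_smul_one, ← hab]
  exact sub_pos.2 (hc.trans_le (csInf_le (finite_spectrum_of_isHermitian hA).bddBelow ha))

end Eigenvalues

theorem leftInv_mul_self {k l : ℕ} {A : Matrix (Fin k) (Fin l) ℝ} (hA : A.rank = l) :
    leftInv A * A = 1 := by
  have hr : (Aᵀ * A).rank = l := by rw [rank_transpose_mul_self, hA]
  have hu : IsUnit (Aᵀ * A).det := by
    rw [← isUnit_iff_isUnit_det]
    refine (mulVec_injective_iff_isUnit).1 ?_
    rw [← coe_mulVecLin, LinearMap.injective_iff_surjective, ← LinearMap.range_eq_top]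
    refine Submodule.eq_top_of_finrank_eq ?_
    rw [← Matrix.rank, hr]; simp
  rw [leftInv, Matrix.mul_assoc, nonsing_inv_mul _ hu]

/-! ### Exponential decay of the matrix exponential of a Hurwitz matrix -/

section Decay

open scoped Matrix.Norms.Operator Nat

variable {k : ℕ}

theorem exp_mulVec_eq_sum (N : Matrix (Fin k) (Fin k) ℂ) (v : Fin k → ℂ) (K : ℕ)
    (h : N ^ K *ᵥ v = 0) :
    NormedSpace.exp N *ᵥ v = ∑ j ∈ Finset.range K, ((j !⁻¹ : ℂ) • N ^ j) *ᵥ v := by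
  have h1 : HasSum (fun j => ((j !⁻¹ : ℂ) • N ^ j) *ᵥ v) (NormedSpace.exp N *ᵥ v) :=
    (NormedSpace.exp_series_hasSum_exp' (𝕂 := ℂ) N).map
      (Matrix.mulVec.addMonoidHomLeft v : Matrix (Fin k) (Fin k) ℂ →+ (Fin k → ℂ))
      (continuous_id.matrix_mulVec continuous_const)
  refine h1.unique (hasSum_sum_of_ne_finset_zero fun j hj => ?_)
  have hj : K ≤ j := by simpa using hj
  obtain ⟨i, rfl⟩ := Nat.exists_eq_add_of_le' hj
  rw [smul_mulVec, pow_add, ← mulVec_mulVec, h, mulVec_zero, smul_zero]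

theorem exp_smul_mulVec_decay_of_genEigenvector {A : Matrix (Fin k) (Fin k) ℂ} {μ : ℂ} {c : ℝ}
    (hμ : μ.re < -c) {v : Fin k → ℂ} {K : ℕ} (h : (A - μ • 1) ^ K *ᵥ v = 0) :
    ∃ C : ℝ, ∀ t : ℝ, 0 ≤ t →
      ‖NormedSpace.exp ((t : ℂ) • A) *ᵥ v‖ ≤ C * Real.exp (-c * t) := by
  set N := A - μ • (1 : Matrix (Fin k) (Fin k) ℂ) with hN
  set δ := -c - μ.re with hδ
  have hδ0 : 0 < δ := by rw [hδ]; linarith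
  refine ⟨∑ j ∈ Finset.range K, (δ ^ j)⁻¹ * ‖N ^ j *ᵥ v‖, fun t ht => ?_⟩
  have hsplit : (t : ℂ) • A = algebraMap ℂ (Matrix (Fin k) (Fin k) ℂ) (t * μ) + (t : ℂ) • N := by
    rw [hN, Algebra.algebraMap_eq_smul_one, smul_sub, smul_smul]; abel
  have hexp : NormedSpace.exp ((t : ℂ) • A) =
      Complex.exp (t * μ) • NormedSpace.exp ((t : ℂ) • N) := by
    have hscal : NormedSpace.exp (algebraMap ℂ (Matrix (Fin k) (Fin k) ℂ) (t * μ)) =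
        algebraMap ℂ _ (Complex.exp (t * μ)) := by
      rw [Complex.exp_eq_exp_ℂ]
      exact (NormedSpace.algebraMap_exp_comm (𝔸 := Matrix (Fin k) (Fin k) ℂ) _).symm
    rw [hsplit, Matrix.exp_add_of_commute _ _ (Algebra.commute_algebraMap_left _ _), hscal,
      ← Algebra.smul_def]
  have hz : ((t : ℂ) • N) ^ K *ᵥ v = 0 := by
    rw [smul_pow, smul_mulVec, h, smul_zero]
  rw [hexp, smul_mulVec, exp_mulVec_eq_sum _ _ _ hz, norm_smul, Complex.norm_exp]
  have hre : ((t : ℂ) * μ).re = t * μ.re := by simp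
  rw [hre]
  have hterm : ∀ j ∈ Finset.range K, ‖((j !⁻¹ : ℂ) • ((t : ℂ) • N) ^ j) *ᵥ v‖ ≤
      Real.exp (δ * t) * ((δ ^ j)⁻¹ * ‖N ^ j *ᵥ v‖) := by
    intro j _
    rw [smul_pow, smul_mulVec, smul_mulVec, norm_smul, norm_smul, ← mul_assoc, ← mul_assoc]
    refine mul_le_mul_of_nonneg_right ?_ (norm_nonneg _)
    have := Real.pow_div_factorial_le_exp _ (mul_nonneg hδ0.le ht) j
    rw [norm_inv, Complex.norm_natCast, norm_pow, Complex.norm_real, Real.norm_of_nonneg ht]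
    rw [mul_pow] at this
    rw [← div_eq_mul_inv, le_div_iff₀ (by positivity)]
    refine le_trans (le_of_eq ?_) this
    field_simp
  refine (mul_le_mul_of_nonneg_left ((norm_sum_le _ _).trans (Finset.sum_le_sum hterm))
    (Real.exp_nonneg _)).trans (le_of_eq ?_)
  rw [← Finset.mul_sum, ← mul_assoc, ← Real.exp_add, mul_comm]
  congr 2
  rw [hδ]; ring

theorem exp_smul_mulVec_decay {A : Matrix (Fin k) (Fin k) ℂ} {c : ℝ}
    (hA : ∀ μ ∈ spectrum ℂ A, μ.re < -c) (v : Fin k → ℂ) :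
    ∃ C : ℝ, ∀ t : ℝ, 0 ≤ t →
      ‖NormedSpace.exp ((t : ℂ) • A) *ᵥ v‖ ≤ C * Real.exp (-c * t) := by
  have hv : v ∈ ⨆ μ, Module.End.maxGenEigenspace (toLin' A) μ := by
    rw [Module.End.iSup_maxGenEigenspace_eq_top]; trivial
  refine Submodule.iSup_induction _ (motive := fun v => ∃ C : ℝ, ∀ t : ℝ, 0 ≤ t →
      ‖NormedSpace.exp ((t : ℂ) • A) *ᵥ v‖ ≤ C * Real.exp (-c * t)) hv ?_ ?_ ?_
  · intro μ w hw
    obtain ⟨K, hK⟩ := (Module.End.mem_maxGenEigenspace _ _ _).1 hw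
    by_cases hw0 : w = 0
    · exact ⟨0, fun t _ => by simp [hw0]⟩
    have hμ : μ ∈ spectrum ℂ A := by
      rw [← spectrum_toLin', ← Module.End.hasEigenvalue_iff_mem_spectrum]
      refine Module.End.hasEigenvalue_of_hasGenEigenvalue (k := K) ?_
      intro hbot
      refine hw0 ((Submodule.mem_bot ℂ).1 (hbot ▸ ?_))
      exact Module.End.mem_genEigenspace_nat.2 hK
    refine exp_smul_mulVec_decay_of_genEigenvector (hA μ hμ) (K := K) ?_
    rw [← toLin'_apply, toLin'_pow, map_sub, map_smul, toLin'_one]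
    exact hK
  · exact ⟨0, fun t _ => by simp⟩
  · rintro w₁ w₂ ⟨C₁, h₁⟩ ⟨C₂, h₂⟩
    refine ⟨C₁ + C₂, fun t ht => ?_⟩
    rw [mulVec_add, add_mul]
    exact (norm_add_le _ _).trans (add_le_add (h₁ t ht) (h₂ t ht))

theorem map_exp_smul (A : Matrix (Fin k) (Fin k) ℝ) (t : ℝ) :
    (NormedSpace.exp (t • A)).map (algebraMap ℝ ℂ) =
      NormedSpace.exp ((t : ℂ) • A.map (algebraMap ℝ ℂ)) := by
  have h := NormedSpace.map_exp (algebraMap ℝ ℂ).mapMatrix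
    (continuous_id.matrix_map (continuous_algebraMap ℝ ℂ)) (t • A)
  rw [RingHom.mapMatrix_apply, RingHom.mapMatrix_apply] at h
  refine h.trans ?_
  have h2 : (t • A).map (algebraMap ℝ ℂ) = (t : ℂ) • A.map (algebraMap ℝ ℂ) := by
    ext i j
    simp
  rw [h2]
  rfl

theorem IsHurwitz.exp_entry_decay {A : Matrix (Fin k) (Fin k) ℝ} (hA : IsHurwitz A) :
    ∃ c > 0, ∃ C : ℝ, ∀ t : ℝ, 0 ≤ t → ∀ i j,
      |NormedSpace.exp (t • A) i j| ≤ C * Real.exp (-c * t) := by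
  obtain ⟨c, hc, hsp⟩ : ∃ c > 0, ∀ μ ∈ spectrum ℂ (A.map (algebraMap ℝ ℂ)), μ.re < -c := by
    have hfin : (spectrum ℂ (A.map (algebraMap ℝ ℂ))).Finite := by
      rw [← spectrum_toLin']; exact Module.End.finite_spectrum _
    rcases (spectrum ℂ (A.map (algebraMap ℝ ℂ))).eq_empty_or_nonempty with he | hne
    · exact ⟨1, one_pos, fun μ hμ => by rw [he] at hμ; exact hμ.elim⟩
    · obtain ⟨μ₀, hμ₀, hmax⟩ := hfin.exists_maximalFor Complex.re _ hne
      refine ⟨-μ₀.re / 2, by have := hA μ₀ hμ₀; linarith, fun μ hμ => ?_⟩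
      have h0 := hA μ₀ hμ₀
      have : μ.re ≤ μ₀.re := by
        by_contra hlt
        exact hlt (hmax hμ (le_of_not_ge hlt))
      linarith
  choose C hC using fun j => exp_smul_mulVec_decay hsp (Pi.single j (1 : ℂ))
  refine ⟨c, hc, ∑ j, |C j|, fun t ht i j => ?_⟩
  have h1 := (norm_le_pi_norm _ i).trans (hC j t ht)
  rw [← map_exp_smul, mulVec_single_one] at h1
  simp only [col_apply, map_apply, Complex.coe_algebraMap, Complex.norm_real,
    Real.norm_eq_abs] at h1
  refine h1.trans (mul_le_mul_of_nonneg_right ?_ (Real.exp_nonneg _))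
  exact (le_abs_self _).trans
    (Finset.single_le_sum (f := fun j => |C j|) (fun _ _ => abs_nonneg _) (Finset.mem_univ j))

end Decay

/-! ### Linear filters -/

section Filters

open scoped Matrix.Norms.Operator
open MeasureTheory

variable {k l q : ℕ}

theorem hasDerivAt_exp_smul_entry (A : Matrix (Fin k) (Fin k) ℝ) (t : ℝ) (i j : Fin k) :
    HasDerivAt (fun s : ℝ => NormedSpace.exp (s • A) i j)
      ((A * NormedSpace.exp (t • A)) i j) t :=
  ((Matrix.entryLinearMap ℝ ℝ i j).toContinuousLinearMap.hasFDerivAt).comp_hasDerivAt t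
    (hasDerivAt_exp_smul_const' A t)

theorem exp_smul_mul_comm (A : Matrix (Fin k) (Fin k) ℝ) (t : ℝ) :
    NormedSpace.exp (t • A) * A = A * NormedSpace.exp (t • A) :=
  ((Commute.refl A).smul_left t).exp_left

theorem continuous_exp_smul (A : Matrix (Fin k) (Fin k) ℝ) :
    Continuous fun t : ℝ => NormedSpace.exp (t • A) :=
  continuous_matrix fun i j =>
    continuous_iff_continuousAt.2 fun t => (hasDerivAt_exp_smul_entry A t i j).continuousAt

theorem hasDerivWithinAt_mulVec {ι κ : Type} [Fintype ι] [Fintype κ] {M : ℝ → Matrix ι κ ℝ}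
    {M' : Matrix ι κ ℝ} {z : ℝ → κ → ℝ} {z' : κ → ℝ} {s : Set ℝ} {t : ℝ}
    (hM : ∀ i j, HasDerivWithinAt (fun r => M r i j) (M' i j) s t)
    (hz : HasDerivWithinAt z z' s t) :
    HasDerivWithinAt (fun r => M r *ᵥ z r) (M' *ᵥ z t + M t *ᵥ z') s t := by
  refine hasDerivWithinAt_pi.2 fun i => ?_
  have h := HasDerivWithinAt.fun_sum (u := Finset.univ) fun j _ =>
    (hM i j).fun_mul (hasDerivWithinAt_pi.1 hz j)
  refine h.congr_deriv ?_
  rw [Finset.sum_add_distrib]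
  rfl

theorem hasDerivWithinAt_const_mulVec {ι κ : Type} [Fintype ι] [Fintype κ] (M : Matrix ι κ ℝ)
    {z : ℝ → κ → ℝ} {z' : κ → ℝ} {s : Set ℝ} {t : ℝ} (hz : HasDerivWithinAt z z' s t) :
    HasDerivWithinAt (fun r => M *ᵥ z r) (M *ᵥ z') s t := by
  have h := hasDerivWithinAt_mulVec (M := fun _ => M) (M' := 0)
    (fun i j => hasDerivWithinAt_const t s (M i j)) hz
  simpa using h

theorem l1Norm_nonneg (A : Matrix (Fin k) (Fin k) ℝ) (B : Matrix (Fin k) (Fin l) ℝ)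
    (C : Matrix (Fin q) (Fin k) ℝ) : 0 ≤ l1Norm A B C :=
  Real.iSup_nonneg fun _ => Finset.sum_nonneg fun _ _ => integral_nonneg fun _ => abs_nonneg _

theorem continuous_impulseResponse (A : Matrix (Fin k) (Fin k) ℝ) (B : Matrix (Fin k) (Fin l) ℝ)
    (C : Matrix (Fin q) (Fin k) ℝ) (i : Fin q) (j : Fin l) :
    Continuous fun t : ℝ => (C * NormedSpace.exp (t • A) * B) i j :=
  ((continuous_const.matrix_mul (continuous_exp_smul A)).matrix_mul
    continuous_const).matrix_elem i j

theorem IsHurwitz.integrableOn_impulseResponse {A : Matrix (Fin k) (Fin k) ℝ} (hA : IsHurwitz A)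
    (B : Matrix (Fin k) (Fin l) ℝ) (C : Matrix (Fin q) (Fin k) ℝ) (i : Fin q) (j : Fin l) :
    IntegrableOn (fun t : ℝ => (C * NormedSpace.exp (t • A) * B) i j) (Ioi 0) := by
  obtain ⟨c, hc, M, hM⟩ := hA.exp_entry_decay
  have hentry : ∀ a b, IntegrableOn (fun t : ℝ => NormedSpace.exp (t • A) a b) (Ioi 0) := by
    intro a b
    have hdom : IntegrableOn (fun t : ℝ => M * Real.exp (-c * t)) (Ioi 0) :=
      (integrableOn_exp_mul_Ioi (neg_lt_zero.2 hc) 0).const_mul M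
    refine Integrable.mono' hdom
      ((continuous_exp_smul A).matrix_elem a b).aestronglyMeasurable ?_
    filter_upwards [ae_restrict_mem measurableSet_Ioi] with t ht
    exact hM t (le_of_lt ht) a b
  simp only [mul_apply]
  exact integrable_finsetSum _ fun a _ =>
    (integrable_finsetSum _ fun b _ => (hentry b a).const_mul _).mul_const _

/-- The peak of the output of a stable strictly proper filter started at rest is at most the `𝓛₁`
norm of the filter times the peak of its input. -/
theorem norm_output_le_l1Norm {A : Matrix (Fin k) (Fin k) ℝ} (hA : IsHurwitz A)
    (B : Matrix (Fin k) (Fin l) ℝ) (C : Matrix (Fin q) (Fin k) ℝ) {z : ℝ → Fin k → ℝ}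
    {w : ℝ → Fin l → ℝ} {τ ρ : ℝ} (hz0 : z 0 = 0)
    (hz : ∀ t ∈ Icc 0 τ, HasDerivWithinAt z (A *ᵥ z t + B *ᵥ w t) (Icc 0 τ) t)
    (hw : ContinuousOn w (Icc 0 τ)) (hρ : ∀ t ∈ Icc 0 τ, ‖w t‖ ≤ ρ) {t : ℝ} (ht : t ∈ Icc 0 τ) :
    ‖C *ᵥ z t‖ ≤ l1Norm A B C * ρ := by
  have hρ0 : 0 ≤ ρ := (norm_nonneg _).trans (hρ t ht)
  refine (pi_norm_le_iff_of_nonneg (mul_nonneg (l1Norm_nonneg A B C) hρ0)).2 fun i => ?_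
  set h : ℝ → Fin l → ℝ := fun s j => (C * NormedSpace.exp (s • A) * B) i j with hh
  have hhc : ∀ j, Continuous fun s => h s j := fun j => continuous_impulseResponse A B C i j
  have hsub : Icc 0 t ⊆ Icc 0 τ := Icc_subset_Icc_right ht.2
  have hzd : ∀ s ∈ Icc 0 τ, HasDerivWithinAt
      (fun s => C *ᵥ (NormedSpace.exp ((t - s) • A) *ᵥ z s))
      ((C * NormedSpace.exp ((t - s) • A) * B) *ᵥ w s) (Icc 0 τ) s := by
    intro s hs
    have h1 : ∀ a b, HasDerivWithinAt (fun r : ℝ => NormedSpace.exp ((t - r) • A) a b)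
        ((-(A * NormedSpace.exp ((t - s) • A))) a b) (Icc 0 τ) s := by
      intro a b
      have := (hasDerivAt_exp_smul_entry A (t - s) a b).comp s
        ((hasDerivAt_id s).const_sub t)
      refine (this.congr_deriv ?_).hasDerivWithinAt
      simp
    refine (hasDerivWithinAt_const_mulVec C (hasDerivWithinAt_mulVec h1 (hz s hs))).congr_deriv ?_
    rw [← exp_smul_mul_comm, neg_mulVec, ← mulVec_mulVec, mulVec_add (NormedSpace.exp _),
      neg_add_cancel_left, mulVec_mulVec, mulVec_mulVec]
  have hint : IntervalIntegrable (fun s => h (t - s) ⬝ᵥ w s) volume 0 t := by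
    refine ContinuousOn.intervalIntegrable_of_Icc ht.1 ?_
    refine continuousOn_finsetSum _ fun j _ => ?_
    exact ((hhc j).comp (continuous_const.sub continuous_id)).continuousOn.mul
      ((continuous_apply j).comp_continuousOn (hw.mono hsub))
  have hftc := intervalIntegral.integral_eq_sub_of_hasDerivAt_of_le ht.1
    (f := fun s => (C *ᵥ (NormedSpace.exp ((t - s) • A) *ᵥ z s)) i)
    (f' := fun s => h (t - s) ⬝ᵥ w s)
    (fun s hs => (hasDerivWithinAt_pi.1 (hzd s (hsub hs)) i).continuousWithinAt.mono hsub)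
    (fun s hs => (hasDerivWithinAt_pi.1 (hzd s (hsub (Ioo_subset_Icc_self hs))) i).hasDerivAt
      (Icc_mem_nhds hs.1 (hs.2.trans_le ht.2))) hint
  simp only [sub_self, zero_smul, NormedSpace.exp_zero, one_mulVec, hz0, mulVec_zero,
    Pi.zero_apply, sub_zero] at hftc
  have hhint : ∀ j, IntervalIntegrable (fun s => |h (t - s) j| * ρ) volume 0 t := fun j =>
    (((hhc j).comp (continuous_const.sub continuous_id)).abs.mul
      continuous_const).intervalIntegrable _ _
  have hbd : ‖∫ s in (0 : ℝ)..t, h (t - s) ⬝ᵥ w s‖ ≤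
      ∫ s in (0 : ℝ)..t, ∑ j, |h (t - s) j| * ρ := by
    refine intervalIntegral.norm_integral_le_of_norm_le ht.1 ?_ ?_
    · refine Filter.Eventually.of_forall fun s hs => ?_
      refine (norm_sum_le _ _).trans (Finset.sum_le_sum fun j _ => ?_)
      rw [norm_mul, Real.norm_eq_abs]
      exact mul_le_mul_of_nonneg_left ((norm_le_pi_norm _ j).trans
        (hρ s (hsub (Ioc_subset_Icc_self hs)))) (abs_nonneg _)
    · exact (continuous_finsetSum _ fun j _ =>
        ((hhc j).comp (continuous_const.sub continuous_id)).abs.mul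
          continuous_const).intervalIntegrable _ _
  have hle : ∫ s in (0 : ℝ)..t, ∑ j, |h (t - s) j| * ρ ≤
      (∑ j, ∫ s in Ioi (0 : ℝ), |h s j|) * ρ := by
    rw [intervalIntegral.integral_finsetSum fun j _ => hhint j, Finset.sum_mul]
    refine Finset.sum_le_sum fun j _ => ?_
    rw [intervalIntegral.integral_mul_const]
    refine mul_le_mul_of_nonneg_right ?_ hρ0
    rw [intervalIntegral.integral_comp_sub_left (fun s => |h s j|) t, sub_self, sub_zero,
      intervalIntegral.integral_of_le ht.1]
    refine setIntegral_mono_set (hA.integrableOn_impulseResponse B C i j).abs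
      (Filter.Eventually.of_forall fun _ => abs_nonneg _) ?_
    exact (Ioc_subset_Ioi_self).eventuallyLE
  rw [← hftc]
  refine hbd.trans (hle.trans (mul_le_mul_of_nonneg_right ?_ hρ0))
  exact le_ciSup (f := fun i => ∑ j : Fin l, ∫ t in Ioi (0 : ℝ),
    |(C * NormedSpace.exp (t • A) * B) i j|) (finite_range _).bddAbove i

theorem exists_linear_ode_solution (A : Matrix (Fin k) (Fin k) ℝ) (B : Matrix (Fin k) (Fin l) ℝ)
    {w : ℝ → Fin l → ℝ} {τ : ℝ} (hτ : 0 ≤ τ) (hw : ContinuousOn w (Icc 0 τ)) :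
    ∃ z : ℝ → Fin k → ℝ, z 0 = 0 ∧
      ∀ t ∈ Icc 0 τ, HasDerivWithinAt z (A *ᵥ z t + B *ᵥ w t) (Icc 0 τ) t := by
  set w' : ℝ → Fin l → ℝ := IccExtend hτ ((Icc 0 τ).domRestrict w) with hw'
  have hw'c : Continuous w' := (continuousOn_iff_continuous_domRestrict.1 hw).Icc_extend'
  set g : ℝ → Fin k → ℝ := fun s => NormedSpace.exp ((-s) • A) *ᵥ (B *ᵥ w' s) with hg
  have hgc : Continuous g :=
    ((continuous_exp_smul A).comp continuous_neg).matrix_mulVec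
      (continuous_const.matrix_mulVec hw'c)
  refine ⟨fun t => NormedSpace.exp (t • A) *ᵥ ∫ s in (0 : ℝ)..t, g s, by simp, fun t ht => ?_⟩
  have hF : HasDerivWithinAt (fun t => ∫ s in (0 : ℝ)..t, g s) (g t) (Icc 0 τ) t :=
    (hgc.integral_hasStrictDerivAt 0 t).hasDerivAt.hasDerivWithinAt
  refine (hasDerivWithinAt_mulVec
    (fun i j => (hasDerivAt_exp_smul_entry A t i j).hasDerivWithinAt) hF).congr_deriv ?_
  have hinv : NormedSpace.exp (t • A) * NormedSpace.exp ((-t) • A) = 1 := by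
    rw [← Matrix.exp_add_of_commute _ _ (((Commute.refl A).smul_left t).smul_right (-t)),
      ← add_smul, add_neg_cancel, zero_smul, NormedSpace.exp_zero]
  have hwt : w' t = w t := by
    rw [hw', IccExtend_of_mem hτ _ ht]; rfl
  rw [hg]
  simp only [mulVec_mulVec, ← Matrix.mul_assoc, hinv, Matrix.one_mul, hwt]

end Filters

/-! ### Differential inequalities -/

section Comparison

open scoped Topology

theorem hasDerivWithinAt_Ici_of_Icc {E : Type*} [NormedAddCommGroup E] [NormedSpace ℝ E]
    {f : ℝ → E} {f' : E} {τ x : ℝ} (hx : x ∈ Ico 0 τ) (h : HasDerivWithinAt f f' (Icc 0 τ) x) :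
    HasDerivWithinAt f f' (Ici x) x :=
  h.mono_of_mem_nhdsWithin (Icc_mem_nhdsGE_of_mem hx)

/-- A function which does not increase where it exceeds `b` stays below `b`. -/
theorem le_of_deriv_nonpos_above {h h' : ℝ → ℝ} {τ b : ℝ}
    (hd : ∀ t ∈ Icc 0 τ, HasDerivWithinAt h (h' t) (Icc 0 τ) t) (h0 : h 0 ≤ b)
    (hb : ∀ t ∈ Icc 0 τ, b < h t → h' t ≤ 0) {t : ℝ} (ht : t ∈ Icc 0 τ) : h t ≤ b := by
  have key : ∀ δ > 0, h t ≤ b + δ * (1 + t) := by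
    intro δ hδ
    refine image_le_of_deriv_right_lt_deriv_boundary' (B := fun s => b + δ * (1 + s))
      (B' := fun _ => δ) (fun s hs => (hd s hs).continuousWithinAt)
      (fun s hs => hasDerivWithinAt_Ici_of_Icc hs (hd s (Ico_subset_Icc_self hs))) ?_
      (by fun_prop) ?_ ?_ ht
    · linarith
    · intro s _
      have := ((((hasDerivAt_id s).const_add 1).const_mul δ).const_add b).hasDerivWithinAt
        (s := Ici s)
      simpa using this
    · intro s hs hsb
      refine (hb s (Ico_subset_Icc_self hs) ?_).trans_lt hδ
      rw [hsb]
      have : 0 < δ * (1 + s) := mul_pos hδ (by linarith [hs.1])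
      linarith
  refine le_of_forall_pos_le_add fun η hη => ?_
  have h1 : 0 < 1 + t := by linarith [ht.1]
  have := key (η / (1 + t)) (by positivity)
  rwa [div_mul_cancel₀ _ h1.ne'] at this

/-- A Gronwall inequality for a continuous function that need not be differentiable, but touches
from below, at every point, a function with a suitable derivative there. -/
theorem le_exp_of_upper_comparison {V : ℝ → ℝ} {τ lam c : ℝ} (hV : ContinuousOn V (Icc 0 τ))
    (hU : ∀ x ∈ Ico 0 τ, ∃ (U : ℝ → ℝ) (U' : ℝ), HasDerivWithinAt U U' (Icc 0 τ) x ∧ U x = V x ∧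
      (∀ z ∈ Icc x τ, V z ≤ U z) ∧ U' ≤ -lam * (V x - c)) {t : ℝ} (ht : t ∈ Icc 0 τ) :
    V t ≤ c + (V 0 - c) * Real.exp (-lam * t) := by
  choose! U U' hd hUx hle hU' using hU
  have h := le_gronwallBound_of_liminf_deriv_right_le (f := fun s => V s - c) (f' := U')
    (δ := V 0 - c) (K := -lam) (ε := 0) (a := 0) (b := τ)
    (hV.sub continuousOn_const) ?_ le_rfl (fun x hx => by simpa using hU' x hx) t ht
  · rw [gronwallBound_ε0, sub_zero] at h
    linarith
  · intro x hx r hr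
    have h1 := (hasDerivWithinAt_iff_tendsto_slope.1
      (hasDerivWithinAt_Ici_of_Icc hx (hd x hx))).eventually_lt_const hr
    rw [Ici_sdiff_left] at h1
    have h2 : ∀ᶠ z in 𝓝[>] x, z ∈ Ioc x τ := Ioc_mem_nhdsGT hx.2
    refine (Filter.Eventually.frequently ?_)
    filter_upwards [h1, h2] with z hz1 hz2
    refine lt_of_le_of_lt ?_ hz1
    rw [slope_def_field, div_eq_inv_mul]
    have := hle x hx z (Ioc_subset_Icc_self hz2)
    exact mul_le_mul_of_nonneg_left (by rw [hUx x hx]; linarith)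
      (inv_nonneg.2 (sub_nonneg.2 hz2.1.le))

theorem hasDerivWithinAt_dotProduct {ι : Type} [Fintype ι] {v w : ℝ → ι → ℝ} {v' w' : ι → ℝ}
    {s : Set ℝ} {t : ℝ} (hv : HasDerivWithinAt v v' s t) (hw : HasDerivWithinAt w w' s t) :
    HasDerivWithinAt (fun r => v r ⬝ᵥ w r) (v' ⬝ᵥ w t + v t ⬝ᵥ w') s t := by
  have h := HasDerivWithinAt.fun_sum (u := Finset.univ) fun j _ =>
    (hasDerivWithinAt_pi.1 hv j).fun_mul (hasDerivWithinAt_pi.1 hw j)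
  refine h.congr_deriv ?_
  rw [Finset.sum_add_distrib]
  rfl

theorem hasDerivWithinAt_quadraticForm {ι : Type} [Fintype ι] {P : Matrix ι ι ℝ} (hP : Pᵀ = P)
    {v : ℝ → ι → ℝ} {v' : ι → ℝ} {s : Set ℝ} {t : ℝ} (hv : HasDerivWithinAt v v' s t) :
    HasDerivWithinAt (fun r => v r ⬝ᵥ (P *ᵥ v r)) (2 * (v t ⬝ᵥ (P *ᵥ v'))) s t := by
  refine (hasDerivWithinAt_dotProduct hv (hasDerivWithinAt_const_mulVec P hv)).congr_deriv ?_
  rw [dotProduct_mulVec, ← mulVec_transpose, hP, dotProduct_comm]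
  ring

end Comparison

/-! ### The smooth projection operator -/

section Projection

variable {E : Type} [NormedAddCommGroup E] [InnerProductSpace ℝ E]

theorem inner_sub_smoothProj_sub_nonpos {ε R : ℝ} (hε : 0 < ε) (hR : 0 ≤ R) {c θ θs : E} (y : E)
    (hs : ‖θs - c‖ ≤ R) : inner ℝ (θ - θs) (smoothProj ε c R θ y - y) ≤ 0 := by
  rw [smoothProj]
  split_ifs with h
  · obtain ⟨hg, hip⟩ := h
    have hRd : R ≤ ‖θ - c‖ := by
      rcases hR.eq_or_lt with rfl | hR0
      · exact norm_nonneg _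
      · have : 0 ≤ ‖θ - c‖ ^ 2 - R ^ 2 := by
          rw [div_nonneg_iff] at hg
          rcases hg with hg | hg
          · exact hg.1
          · have : 0 < ε * R ^ 2 := by positivity
            linarith [hg.2]
        exact (pow_le_pow_iff_left₀ hR (norm_nonneg _) two_ne_zero).1 (by linarith)
    have h1 : 0 ≤ inner ℝ (θ - θs) (θ - c) := by
      have : θ - θs = (θ - c) - (θs - c) := by abel
      rw [this, inner_sub_left, real_inner_self_eq_norm_sq]
      have h2 := real_inner_le_norm (θs - c) (θ - c)
      nlinarith [norm_nonneg (θ - c)]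
    rw [sub_sub_cancel_left, inner_neg_right, inner_smul_right]
    have : 0 ≤ (‖θ - c‖ ^ 2 - R ^ 2) / (ε * R ^ 2) * inner ℝ (θ - c) y / ‖θ - c‖ ^ 2 := by
      positivity
    have := mul_nonneg this h1
    linarith
  · simp

theorem inner_smoothProj_nonpos {ε R : ℝ} (hε : 0 < ε) (hR : 0 < R) {c θ : E} (y : E)
    (hθ : (1 + ε) * R ^ 2 < ‖θ - c‖ ^ 2) : inner ℝ (θ - c) (smoothProj ε c R θ y) ≤ 0 := by
  have hpos : 0 < ε * R ^ 2 := by positivity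
  have hg : 1 ≤ (‖θ - c‖ ^ 2 - R ^ 2) / (ε * R ^ 2) := by
    rw [le_div_iff₀ hpos]; linarith
  rw [smoothProj]
  split_ifs with h
  · have hd : ‖θ - c‖ ^ 2 ≠ 0 := by
      have : 0 < (1 + ε) * R ^ 2 := by positivity
      linarith
    rw [inner_sub_right, inner_smul_right, real_inner_self_eq_norm_sq, div_mul_cancel₀ _ hd]
    nlinarith [h.2]
  · by_contra hip
    exact h ⟨by linarith, not_le.1 hip⟩

theorem dotProduct_eq_inner {k : ℕ} (v w : Fin k → ℝ) :
    v ⬝ᵥ w = inner ℝ (WithLp.toLp 2 v : EuclideanSpace ℝ (Fin k)) (WithLp.toLp 2 w) := by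
  rw [EuclideanSpace.inner_eq_star_dotProduct, star_trivial, dotProduct_comm]

theorem dotProduct_vecProj_sub_nonpos {k : ℕ} {ε R : ℝ} (hε : 0 < ε) (hR : 0 ≤ R)
    {θ θs : Fin k → ℝ} (y : Fin k → ℝ) (hs : θs ⬝ᵥ θs ≤ R ^ 2) :
    (θ - θs) ⬝ᵥ (vecProj ε R θ y - y) ≤ 0 := by
  rw [dotProduct_eq_inner]
  refine inner_sub_smoothProj_sub_nonpos hε hR (θ := WithLp.toLp 2 θ) (θs := WithLp.toLp 2 θs)
    (c := 0) (WithLp.toLp 2 y) ?_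
  rw [sub_zero]
  rw [dotProduct_self_eq_norm_sq] at hs
  exact (pow_le_pow_iff_left₀ (norm_nonneg _) hR two_ne_zero).1 hs

theorem dotProduct_vecProj_nonpos {k : ℕ} {ε R : ℝ} (hε : 0 < ε) (hR : 0 < R)
    {θ : Fin k → ℝ} (y : Fin k → ℝ) (hθ : (1 + ε) * R ^ 2 < θ ⬝ᵥ θ) :
    θ ⬝ᵥ vecProj ε R θ y ≤ 0 := by
  rw [dotProduct_eq_inner]
  rw [dotProduct_self_eq_norm_sq] at hθ
  have := inner_smoothProj_nonpos hε hR (c := 0) (θ := (WithLp.toLp 2 θ : EuclideanSpace ℝ (Fin k)))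
    (WithLp.toLp 2 y) (by rwa [sub_zero])
  rwa [sub_zero] at this

/-- Trajectories of the projected adaptive law stay in the enlarged ball. -/
theorem dotProduct_self_le_of_vecProj_ode {k : ℕ} {ε R Γ τ : ℝ} (hε : 0 < ε)
    (hR : 0 < R ∨ k = 0) (hΓ : 0 < Γ) {θ z : ℝ → Fin k → ℝ} (h0 : θ 0 = 0)
    (hd : ∀ t ∈ Icc 0 τ, HasDerivWithinAt θ (Γ • vecProj ε R (θ t) (z t)) (Icc 0 τ) t)
    {t : ℝ} (ht : t ∈ Icc 0 τ) : θ t ⬝ᵥ θ t ≤ (1 + ε) * R ^ 2 := by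
  rcases hR with hR | rfl
  · refine le_of_deriv_nonpos_above (h := fun t => θ t ⬝ᵥ θ t)
      (fun s hs => hasDerivWithinAt_dotProduct (hd s hs) (hd s hs)) ?_ ?_ ht
    · simp only [h0, dotProduct_zero]; positivity
    · intro s _ hlt
      have := dotProduct_vecProj_nonpos hε hR (z s) hlt
      rw [dotProduct_comm, dotProduct_smul, smul_eq_mul]
      nlinarith
  · rw [dotProduct_of_isEmpty]; positivity

theorem abs_sub_le_of_smoothProj_ode {ε c R Γ τ : ℝ} (hε : 0 < ε) (hR : 0 < R) (hΓ : 0 < Γ)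
    {ω z : ℝ → ℝ} (h0 : |ω 0 - c| ≤ R)
    (hd : ∀ t ∈ Icc 0 τ, HasDerivWithinAt ω (Γ * smoothProj ε c R (ω t) (z t)) (Icc 0 τ) t)
    {t : ℝ} (ht : t ∈ Icc 0 τ) : (ω t - c) ^ 2 ≤ (1 + ε) * R ^ 2 := by
  refine le_of_deriv_nonpos_above (h := fun t => (ω t - c) ^ 2)
    (fun s hs => ((hd s hs).sub_const c).fun_pow 2) ?_ ?_ ht
  · have := sq_le_sq' (by linarith [abs_le.1 h0]) (abs_le.1 h0).2
    nlinarith [sq_nonneg R]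
  · intro s _ hlt
    have := inner_smoothProj_nonpos (θ := ω s) hε hR (z s) (by simpa using hlt)
    rw [real_inner_eq_re_inner, RCLike.inner_apply] at this
    simp only [conj_trivial, RCLike.re_to_real] at this
    simp only [Nat.cast_ofNat, Nat.add_one_sub_one, pow_one]
    nlinarith

end Projection

/-! ### Consequences of the design constraints -/

namespace Design

variable {n m p nz : ℕ} {S : Design n m p nz}

theorem Admissible.n_pos (hS : S.Admissible) : 0 < n := by
  rcases Nat.eq_zero_or_pos n with rfl | h
  · have h1 := hS.εq_pos.trans hS.εq_lt
    have : spectrum ℝ S.Q = ∅ := spectrum.of_subsingleton _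
    rw [lambdaMin, this, Real.sInf_empty] at h1
    exact (lt_irrefl _ h1).elim
  · exact h

theorem Admissible.isUnit_Az (hS : S.Admissible) : IsUnit S.Az.det := by
  have h0 : (0 : ℂ) ∉ spectrum ℂ (S.Az.map (algebraMap ℝ ℂ)) := fun h => by
    simpa using hS.Az_hurwitz 0 h
  rw [spectrum.zero_notMem_iff, isUnit_iff_isUnit_det, isUnit_iff_ne_zero] at h0
  rw [isUnit_iff_ne_zero]
  intro hdet
  refine h0 ?_
  have := (algebraMap ℝ ℂ).map_det S.Az
  rw [RingHom.mapMatrix_apply] at this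
  rw [← this, hdet, map_zero]

theorem Admissible.CmTz (hS : S.Admissible) : S.Cm * S.Tz = 0 := by
  have h1 : S.Cm * S.Tz * S.Az = 0 := by
    have h2 := hS.CmAmTz
    rw [Matrix.mul_assoc, hS.AmTz, Matrix.mul_add, ← Matrix.mul_assoc, ← Matrix.mul_assoc] at h2
    simpa using h2
  have h3 := congrArg (· * S.Az⁻¹) h1
  simpa [Matrix.mul_assoc, mul_nonsing_inv _ hS.isUnit_Az] using h3

theorem Admissible.Cz_or_Dz_ne_zero (hS : S.Admissible) (hm : 0 < m) : S.Cz ≠ 0 ∨ S.Dz ≠ 0 := by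
  by_contra! h
  have : Nonempty (Fin m) := ⟨⟨0, hm⟩⟩
  refine hS.pencil 0 ?_
  rw [h.1, h.2, Matrix.map_zero _ (map_zero _), Matrix.map_zero _ (map_zero _),
    det_fromBlocks_zero₂₁, det_zero, mul_zero]

theorem Admissible.leftInv_Tz (hS : S.Admissible) : leftInv S.Tz * S.Tz = 1 :=
  leftInv_mul_self hS.rank_Tz

theorem Admissible.Cz_mul_leftInv_ne_zero (hS : S.Admissible) (h : S.Cz ≠ 0) :
    S.Cz * leftInv S.Tz ≠ 0 := fun h0 => h <| by
  rw [← Matrix.mul_one S.Cz, ← hS.leftInv_Tz, ← Matrix.mul_assoc, h0, Matrix.zero_mul]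

theorem Tg_mulVec_elim (S : Design n m p nz) (ω : ℝ) (a : Fin n → ℝ) (b : Fin nz → ℝ) :
    S.Tg ω *ᵥ Sum.elim a b = a + ω • (S.Tz *ᵥ b) := by
  rw [Tg, fromCols_mulVec]
  simp [smul_mulVec]

theorem continuous_Tg (S : Design n m p nz) : Continuous S.Tg := by
  refine continuous_matrix fun i j => ?_
  rcases j with j | j
  · simp only [Tg, fromCols_apply_inl]; fun_prop
  · simp only [Tg, fromCols_apply_inr, Matrix.smul_apply, smul_eq_mul]; fun_prop

theorem Admissible.d_ρx_pos (hS : S.Admissible) : 0 < S.d S.ρx := hS.d_pos _ hS.ρx_pos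

theorem le_dBar (S : Design n m p nz) {ω : ℝ} (hω : ω ∈ Icc S.ωl S.ωu) :
    infNorm (S.Cz * leftInv S.Tz * S.Tg ω) + infNorm S.Dz * infNorm (S.Tg ω) * S.d S.ρx ≤
      S.dBar := by
  refine le_csSup ?_ (mem_image_of_mem _ hω)
  refine (isCompact_Icc.image ?_).bddAbove
  have h1 := S.continuous_Tg
  exact (continuous_infNorm.comp (continuous_const.matrix_mul h1)).add
    ((continuous_const.mul (continuous_infNorm.comp h1)).mul continuous_const)

theorem Admissible.dBar_nonneg (hS : S.Admissible) : 0 ≤ S.dBar :=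
  (add_nonneg (infNorm_nonneg _) (mul_nonneg (mul_nonneg (infNorm_nonneg _) (infNorm_nonneg _))
    hS.d_ρx_pos.le)).trans (S.le_dBar hS.one_mem)

theorem Admissible.dBar_pos (hS : S.Admissible) (hm : 0 < m) : 0 < S.dBar := by
  refine lt_of_lt_of_le ?_ (S.le_dBar hS.one_mem)
  rcases hS.Cz_or_Dz_ne_zero hm with h | h
  · refine add_pos_of_pos_of_nonneg (infNorm_pos ?_)
      (mul_nonneg (mul_nonneg (infNorm_nonneg _) (infNorm_nonneg _)) hS.d_ρx_pos.le)
    intro h0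
    refine hS.Cz_mul_leftInv_ne_zero h ?_
    rw [Tg, mul_fromCols, Matrix.mul_one] at h0
    ext i j
    have := congrFun (congrFun h0 i) (Sum.inl j)
    simpa using this
  · refine add_pos_of_nonneg_of_pos (infNorm_nonneg _)
      (mul_pos (mul_pos (infNorm_pos h) (infNorm_pos ?_)) hS.d_ρx_pos)
    intro h0
    have := congrFun (congrFun h0 ⟨0, hS.n_pos⟩) (Sum.inl ⟨0, hS.n_pos⟩)
    simp [Tg] at this

theorem Admissible.bBar_nonneg (hS : S.Admissible) : 0 ≤ S.bBar := by
  have h1 := infNorm_nonneg (S.Cz * leftInv S.Tz)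
  have h2 := infNorm_nonneg S.Dz
  have h3 := l1Norm_nonneg S.Az S.Bz S.Tz
  have h4 := hS.d_ρx_pos
  have h5 := hS.ρx_pos
  have h6 := hS.b₀_pos
  rw [bBar]; positivity

theorem Admissible.bBar_pos (hS : S.Admissible) (hm : 0 < m) : 0 < S.bBar := by
  have h1 := infNorm_nonneg (S.Cz * leftInv S.Tz)
  have h2 := infNorm_nonneg S.Dz
  have h3 := l1Norm_nonneg S.Az S.Bz S.Tz
  have h4 := hS.d_ρx_pos
  have h5 := hS.ρx_pos
  have h6 := hS.b₀_pos
  rw [bBar]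
  rcases hS.Cz_or_Dz_ne_zero hm with h | h
  · have := infNorm_pos (hS.Cz_mul_leftInv_ne_zero h)
    positivity
  · have := infNorm_pos h
    positivity

theorem Admissible.Am_mulVec_Tz (hS : S.Admissible) (z : Fin nz → ℝ) :
    S.Am *ᵥ (S.Tz *ᵥ z) = S.Tz *ᵥ (S.Az *ᵥ z) + S.Bbar *ᵥ (S.Cz *ᵥ z) := by
  simp only [mulVec_mulVec, hS.AmTz, add_mulVec]

theorem Admissible.Bm_mulVec (hS : S.Admissible) (w : Fin m → ℝ) :
    S.Bm *ᵥ w = S.Tz *ᵥ (S.Bz *ᵥ w) + S.Bbar *ᵥ (S.Dz *ᵥ w) := by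
  simp only [mulVec_mulVec, hS.Bm_eq, add_mulVec]

/-- The vector field of the plant, split along the interactor. -/
theorem Admissible.plant_field_eq (hS : S.Admissible) (ω : ℝ) (xv : Fin n → ℝ)
    (xu xf : Fin nz → ℝ) (u F : Fin m → ℝ) :
    S.Am *ᵥ (xv + ω • (S.Tz *ᵥ xu) + S.Tz *ᵥ xf) + S.Bm *ᵥ (ω • u + F) =
      (S.Am *ᵥ xv + S.Bbar *ᵥ (ω • (S.Cz *ᵥ xu + S.Dz *ᵥ u) + (S.Cz *ᵥ xf + S.Dz *ᵥ F))) +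
        ω • (S.Tz *ᵥ (S.Az *ᵥ xu + S.Bz *ᵥ u)) + S.Tz *ᵥ (S.Az *ᵥ xf + S.Bz *ᵥ F) := by
  simp only [mulVec_add, mulVec_smul, hS.Am_mulVec_Tz, hS.Bm_mulVec, smul_add]
  abel

/-- The output derivative of the plant in terms of the virtual system. -/
theorem Admissible.output_field_eq (hS : S.Admissible) (ω : ℝ) (xv : Fin n → ℝ)
    (xu xf : Fin nz → ℝ) (u F : Fin m → ℝ) :
    S.Cm *ᵥ (S.Am *ᵥ (xv + ω • (S.Tz *ᵥ xu) + S.Tz *ᵥ xf) + S.Bm *ᵥ (ω • u + F)) =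
      (S.Cm * S.Am) *ᵥ xv +
        (S.Cm * S.Bbar) *ᵥ (ω • (S.Cz *ᵥ xu + S.Dz *ᵥ u) + (S.Cz *ᵥ xf + S.Dz *ᵥ F)) := by
  have h : ∀ z : Fin nz → ℝ, S.Cm *ᵥ (S.Tz *ᵥ z) = 0 := fun z => by
    rw [mulVec_mulVec, hS.CmTz, zero_mulVec]
  rw [hS.plant_field_eq, mulVec_add, mulVec_add, mulVec_smul, h, h, smul_zero, add_zero, add_zero,
    mulVec_add, mulVec_mulVec, mulVec_mulVec]

theorem Admissible.H_mul_Cm_mul_Bbar (hS : S.Admissible) : S.H * (S.Cm * S.Bbar) = S.Bbar := by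
  rw [H, Matrix.mul_assoc, leftInv_mul_self hS.rank_CmBbar, Matrix.mul_one]

end Design

/-! ### The uncertainty -/

namespace Unknowns.Admissible

variable {n m p nz : ℕ} {S : Design n m p nz} {W : Unknowns n m}

theorem differentiableAt (hW : W.Admissible S) (x : Fin n → ℝ) {t : ℝ} (ht : 0 ≤ t) :
    DifferentiableAt ℝ (fun z => W.f z t) x :=
  (hW.f_dx (‖x‖ + 1) (by positivity) x (by linarith) t ht).1

theorem norm_sub_le_state (hW : W.Admissible S) {δ : ℝ} {x x' : Fin n → ℝ}
    (hx : ‖x‖ < δ) (hx' : ‖x'‖ < δ) {t : ℝ} (ht : 0 ≤ t) :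
    ‖W.f x t - W.f x' t‖ ≤ S.d δ * ‖x - x'‖ := by
  have hδ : 0 < δ := (norm_nonneg _).trans_lt hx
  refine Convex.norm_image_sub_le_of_norm_fderiv_le (𝕜 := ℝ) (f := fun z => W.f z t)
    (s := Metric.ball 0 δ)
    (fun z hz => (hW.f_dx δ hδ z (by simpa using hz) t ht).1)
    (fun z hz => (hW.f_dx δ hδ z (by simpa using hz) t ht).2) (convex_ball 0 δ)
    (by simpa using hx') (by simpa using hx)

theorem norm_sub_le_time (hW : W.Admissible S) {δ : ℝ} {x : Fin n → ℝ} (hx : ‖x‖ < δ)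
    {t t' : ℝ} (ht : 0 ≤ t) (ht' : 0 ≤ t') :
    ‖W.f x t - W.f x t'‖ ≤ S.b δ * |t - t'| := by
  have hδ : 0 < δ := (norm_nonneg _).trans_lt hx
  exact Convex.norm_image_sub_le_of_norm_derivWithin_le
    (fun s hs => (hW.f_dt δ hδ x hx s hs).1) (fun s hs => (hW.f_dt δ hδ x hx s hs).2)
    (convex_Ici 0) ht' ht

theorem norm_le (hS : S.Admissible) (hW : W.Admissible S) {x : Fin n → ℝ} (hx : ‖x‖ ≤ S.ρx)
    {t : ℝ} (ht : 0 ≤ t) : ‖W.f x t‖ ≤ S.d S.ρx * ‖x‖ + S.b₀ := by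
  have hcont : Continuous fun z => W.f z t :=
    continuous_iff_continuousAt.2 fun z => (hW.differentiableAt z ht).continuousAt
  have hclosed : IsClosed {z | ‖W.f z t‖ ≤ S.d S.ρx * ‖z‖ + S.b₀} :=
    isClosed_le hcont.norm ((continuous_const.mul continuous_norm).add continuous_const)
  have hball : Metric.ball (0 : Fin n → ℝ) S.ρx ⊆ {z | ‖W.f z t‖ ≤ S.d S.ρx * ‖z‖ + S.b₀} := by
    intro z hz
    have h1 := hW.norm_sub_le_state (x := z) (x' := 0) (by simpa using hz)
      (by simpa using hS.ρx_pos) ht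
    have h2 := norm_le_norm_add_norm_sub' (W.f z t) (W.f 0 t)
    have h3 := hW.f_zero t ht
    rw [sub_zero] at h1
    simp only [mem_ofPred_eq]
    linarith
  refine closure_minimal hball hclosed ?_
  rw [closure_ball _ hS.ρx_pos.ne']
  simpa using hx

theorem norm_sub_le (hS : S.Admissible) (hW : W.Admissible S) {δ L : ℝ} {x x' : Fin n → ℝ}
    (hx : ‖x‖ < δ) (hx' : ‖x'‖ < δ) {t t' : ℝ} (ht : 0 ≤ t) (ht' : 0 ≤ t')
    (hL : ‖x - x'‖ ≤ L * |t - t'|) :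
    ‖W.f x t - W.f x' t'‖ ≤ (S.d δ * L + S.b δ) * |t - t'| := by
  have hδ : 0 < δ := (norm_nonneg _).trans_lt hx
  have h1 := hW.norm_sub_le_state hx hx' ht
  have h2 := hW.norm_sub_le_time hx' ht ht'
  have h3 := norm_sub_le_norm_sub_add_norm_sub (W.f x t) (W.f x' t) (W.f x' t')
  have h4 := mul_le_mul_of_nonneg_left hL (hS.d_pos δ hδ).le
  linarith

theorem continuousOn_comp (hW : W.Admissible S) {x : ℝ → Fin n → ℝ} {τ : ℝ}
    (hx : ContinuousOn x (Icc 0 τ)) : ContinuousOn (fun t => W.f (x t) t) (Icc 0 τ) := by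
  obtain ⟨C, hC⟩ := isCompact_Icc.exists_bound_of_continuousOn hx
  intro t ht
  have hC' : ∀ s ∈ Icc 0 τ, ‖x s‖ < C + 1 := fun s hs => (hC s hs).trans_lt (by linarith)
  rw [ContinuousWithinAt, tendsto_iff_norm_sub_tendsto_zero]
  refine squeeze_zero' (Filter.Eventually.of_forall fun _ => norm_nonneg _)
    (g := fun s => S.d (C + 1) * ‖x s - x t‖ + S.b (C + 1) * |s - t|) ?_ ?_
  · filter_upwards [self_mem_nhdsWithin] with s hs
    have h1 := hW.norm_sub_le_state (hC' s hs) (hC' t ht) hs.1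
    have h2 := hW.norm_sub_le_time (hC' t ht) hs.1 ht.1
    have h3 := norm_sub_le_norm_sub_add_norm_sub (W.f (x s) s) (W.f (x t) s) (W.f (x t) t)
    linarith
  · have h1 : ContinuousWithinAt
        (fun s => S.d (C + 1) * ‖x s - x t‖ + S.b (C + 1) * |s - t|) (Icc 0 τ) t := by
      have := hx t ht
      fun_prop
    have h2 := h1.tendsto
    simpa using h2

end Unknowns.Admissible

/-! ### The virtual system -/

section Virtual

variable {n m p nz mr nd : ℕ} {S : Design n m p nz} {W : Unknowns n m} {K : Controller m mr nd}
  {s : Signals n m p nz nd} {τ : ℝ}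

open scoped NNReal

theorem Signals.IsClosedLoop.continuousOn_u (h : s.IsClosedLoop S W K τ) :
    ContinuousOn s.u (Icc 0 τ) :=
  (Continuous.comp_continuousOn (g := fun v => -(K.Cd *ᵥ v))
    (continuous_const.matrix_mulVec continuous_id).neg h.xd_cont).congr h.u_eq

theorem Signals.IsClosedLoop.continuousOn_x (h : s.IsClosedLoop S W K τ) :
    ContinuousOn s.x (Icc 0 τ) :=
  fun t ht => (h.x_ode t ht).continuousWithinAt

/-- The plant state is recovered from any solution of the virtual system. -/
theorem Signals.IsVirtual.state_eq (hS : S.Admissible) (hW : W.Admissible S)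
    (h : s.IsClosedLoop S W K τ) {xv : ℝ → Fin n → ℝ} {xf : ℝ → Fin nz → ℝ}
    (hv : s.IsVirtual S W τ xv xf) {t : ℝ} (ht : t ∈ Icc 0 τ) :
    S.Tg W.ω *ᵥ s.xg xv t + S.Tz *ᵥ xf t = s.x t := by
  set X : ℝ → Fin n → ℝ := fun t => S.Tg W.ω *ᵥ s.xg xv t + S.Tz *ᵥ xf t with hX
  have hXe : ∀ t, X t = xv t + W.ω • (S.Tz *ᵥ s.xu t) + S.Tz *ᵥ xf t := fun t => by
    simp only [hX, Signals.xg, Design.Tg_mulVec_elim]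
  have hXd : ∀ t ∈ Icc 0 τ, HasDerivWithinAt X
      (S.Am *ᵥ X t + S.Bm *ᵥ (W.ω • s.u t + W.f (X t) t)) (Icc 0 τ) t := by
    intro t ht
    have h1 := ((hv.xv_ode t ht).fun_add ((hasDerivWithinAt_const_mulVec S.Tz
      (h.xu_ode t ht)).fun_const_smul W.ω)).fun_add
      (hasDerivWithinAt_const_mulVec S.Tz (hv.xf_ode t ht))
    have h2 := hS.plant_field_eq W.ω (xv t) (s.xu t) (xf t) (s.u t) (W.f (X t) t)
    rw [← hXe] at h2
    rw [h2]
    exact h1.congr_of_mem (fun r _ => hXe r) ht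
  have hXc : ContinuousOn X (Icc 0 τ) := fun t ht => (hXd t ht).continuousWithinAt
  obtain ⟨C₁, hC₁⟩ := isCompact_Icc.exists_bound_of_continuousOn hXc
  obtain ⟨C₂, hC₂⟩ := isCompact_Icc.exists_bound_of_continuousOn h.continuousOn_x
  set δ := max C₁ C₂ + 1 with hδ
  have hX1 : ∀ t ∈ Icc 0 τ, ‖X t‖ < δ := fun t ht =>
    (hC₁ t ht).trans_lt (by rw [hδ]; linarith [le_max_left C₁ C₂])
  have hx1 : ∀ t ∈ Icc 0 τ, ‖s.x t‖ < δ := fun t ht =>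
    (hC₂ t ht).trans_lt (by rw [hδ]; linarith [le_max_right C₁ C₂])
  have hδ0 : 0 < δ := (norm_nonneg _).trans_lt (hX1 t ht)
  have hK : 0 ≤ infNorm S.Am + infNorm S.Bm * S.d δ :=
    add_nonneg (infNorm_nonneg _) (mul_nonneg (infNorm_nonneg _) (hS.d_pos δ hδ0).le)
  refine ODE_solution_unique_of_mem_Icc_right (E := Fin n → ℝ)
    (v := fun t x => S.Am *ᵥ x + S.Bm *ᵥ (W.ω • s.u t + W.f x t))
    (s := fun _ => Metric.ball 0 δ) (K := NNReal.mk _ hK) ?_ hXc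
    (fun t ht => hasDerivWithinAt_Ici_of_Icc ht (hXd t (Ico_subset_Icc_self ht)))
    (fun t ht => by simpa using hX1 t (Ico_subset_Icc_self ht)) h.continuousOn_x
    (fun t ht => hasDerivWithinAt_Ici_of_Icc ht (h.x_ode t (Ico_subset_Icc_self ht)))
    (fun t ht => by simpa using hx1 t (Ico_subset_Icc_self ht)) ?_ ht
  · intro t ht
    refine LipschitzOnWith.of_dist_le_mul fun x hx x' hx' => ?_
    rw [dist_eq_norm, dist_eq_norm, NNReal.coe_mk]
    have e : S.Am *ᵥ x + S.Bm *ᵥ (W.ω • s.u t + W.f x t) -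
        (S.Am *ᵥ x' + S.Bm *ᵥ (W.ω • s.u t + W.f x' t)) =
        S.Am *ᵥ (x - x') + S.Bm *ᵥ (W.f x t - W.f x' t) := by
      simp only [mulVec_add, mulVec_sub]; abel
    rw [e]
    have h1 := hW.norm_sub_le_state (x := x) (x' := x') (by simpa using hx) (by simpa using hx')
      ht.1
    calc _ ≤ infNorm S.Am * ‖x - x'‖ + infNorm S.Bm * (S.d δ * ‖x - x'‖) :=
          (norm_add_le _ _).trans (add_le_add (norm_mulVec_le_infNorm _ _)
            ((norm_mulVec_le_infNorm _ _).trans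
              (mul_le_mul_of_nonneg_left h1 (infNorm_nonneg _))))
      _ = _ := by ring
  · rw [hXe, hv.xv_zero, hv.xf_zero, h.xu_zero, h.x_zero]
    simp

/-- The virtual system has a solution: drive its filter by the uncertainty along the plant. -/
theorem Signals.IsClosedLoop.exists_isVirtual (hS : S.Admissible) (hW : W.Admissible S)
    (hτ : 0 < τ) (h : s.IsClosedLoop S W K τ) :
    ∃ (xv : ℝ → Fin n → ℝ) (xf : ℝ → Fin nz → ℝ), s.IsVirtual S W τ xv xf := by
  obtain ⟨xf, hxf0, hxf⟩ := exists_linear_ode_solution S.Az S.Bz hτ.le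
    (hW.continuousOn_comp h.continuousOn_x)
  set xv : ℝ → Fin n → ℝ := fun t => s.x t - W.ω • (S.Tz *ᵥ s.xu t) - S.Tz *ᵥ xf t with hxv
  have hX : ∀ t, S.Tg W.ω *ᵥ s.xg xv t + S.Tz *ᵥ xf t = s.x t := fun t => by
    simp only [hxv, Signals.xg, Design.Tg_mulVec_elim]; abel
  have hfv : ∀ t, s.fv S W xv xf t = W.f (s.x t) t := fun t => by rw [Signals.fv, hX]
  refine ⟨xv, xf, hxf0, fun t ht => by rw [hfv]; exact hxf t ht, ?_, fun t ht => ?_⟩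
  · simp [hxv, h.x_zero, h.xu_zero, hxf0]
  · refine (((h.x_ode t ht).fun_sub ((hasDerivWithinAt_const_mulVec S.Tz
      (h.xu_ode t ht)).fun_const_smul W.ω)).fun_sub
      (hasDerivWithinAt_const_mulVec S.Tz (hxf t ht))).congr_deriv ?_
    have h2 := hS.plant_field_eq W.ω (xv t) (s.xu t) (xf t) (s.u t) (W.f (s.x t) t)
    have h3 : xv t + W.ω • (S.Tz *ᵥ s.xu t) + S.Tz *ᵥ xf t = s.x t := by
      simp only [hxv]; abel
    rw [h3] at h2
    rw [h2, Signals.fBar, hfv, Signals.uz]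
    abel

end Virtual

/-! ### Rate bounds for the parametrization of the lumped uncertainty -/

section Rates

theorem norm_div_smul_sub_le {E : Type*} [NormedAddCommGroup E] [NormedSpace ℝ E] {a a' : E}
    {D D' β M₁ M₂ r : ℝ} (hβ : 0 < β) (hD : β ≤ D) (hD' : 0 < D')
    (ha' : ‖a'‖ ≤ D') (h₁ : ‖a - a'‖ ≤ M₁ * r) (h₂ : |D - D'| ≤ M₂ * r) (γ : ℝ) (hγ : 0 ≤ γ) :
    ‖(γ / D) • a - (γ / D') • a'‖ ≤ γ * ((M₁ + M₂) / β) * r := by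
  have hD0 : 0 < D := hβ.trans_le hD
  have e : (γ / D) • a - (γ / D') • a' =
      (γ / D) • ((a - a') - ((D - D') / D') • a') := by
    rw [smul_sub (γ / D) (a - a'), smul_sub (γ / D) a, smul_smul, sub_sub, ← add_smul]
    congr 2
    field_simp
    ring
  rw [e, norm_smul, Real.norm_of_nonneg (div_nonneg hγ hD0.le)]
  have h3 : ‖((D - D') / D') • a'‖ ≤ M₂ * r := by
    rw [norm_smul, Real.norm_eq_abs, abs_div, abs_of_pos hD', div_mul_eq_mul_div,
      div_le_iff₀ hD']
    exact mul_le_mul h₂ ha' (norm_nonneg _) ((abs_nonneg _).trans h₂)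
  have h4 : ‖(a - a') - ((D - D') / D') • a'‖ ≤ (M₁ + M₂) * r := by
    refine (norm_sub_le _ _).trans ?_
    linarith
  have h5 : 0 ≤ (M₁ + M₂) * r := (norm_nonneg _).trans h4
  calc γ / D * ‖(a - a') - ((D - D') / D') • a'‖ ≤ γ / β * ((M₁ + M₂) * r) :=
        mul_le_mul (div_le_div_of_nonneg_left hγ hβ hD) h4 (norm_nonneg _)
          (div_nonneg hγ hβ.le)
    _ = _ := by ring

theorem norm_sub_le_of_hasDerivWithinAt {E : Type*} [NormedAddCommGroup E] [NormedSpace ℝ E]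
    {z z' : ℝ → E} {τ M : ℝ} (hz : ∀ t ∈ Icc 0 τ, HasDerivWithinAt z (z' t) (Icc 0 τ) t)
    (hM : ∀ t ∈ Icc 0 τ, ‖z' t‖ ≤ M) {t t' : ℝ} (ht : t ∈ Icc 0 τ) (ht' : t' ∈ Icc 0 τ) :
    ‖z t - z t'‖ ≤ M * |t - t'| :=
  Convex.norm_image_sub_le_of_norm_hasDerivWithin_le hz hM (convex_Icc 0 τ) ht' ht

theorem norm_linear_comb_le {a b c : ℕ} (A : Matrix (Fin a) (Fin b) ℝ)
    (B : Matrix (Fin a) (Fin c) ℝ) {v : Fin b → ℝ} {w : Fin c → ℝ} {r r' : ℝ} (hv : ‖v‖ ≤ r)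
    (hw : ‖w‖ ≤ r') : ‖A *ᵥ v + B *ᵥ w‖ ≤ infNorm A * r + infNorm B * r' :=
  (norm_add_le _ _).trans (add_le_add
    ((norm_mulVec_le_infNorm A v).trans (mul_le_mul_of_nonneg_left hv (infNorm_nonneg A)))
    ((norm_mulVec_le_infNorm B w).trans (mul_le_mul_of_nonneg_left hw (infNorm_nonneg B))))

variable {n m p nz mr nd : ℕ}

/-- Bound on the uncertainty along the plant. -/
noncomputable def Design.fMax (S : Design n m p nz) : ℝ := S.d S.ρx * S.ρx + S.b₀

/-- Bound on the rate of change of the plant state. -/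
noncomputable def Design.xRate (S : Design n m p nz) : ℝ :=
  infNorm S.Am * S.ρx + infNorm S.Bm * (S.ωu * S.ρu + S.fMax)

/-- Bound on the rate of change of the state of the filter `(Az, Bz)` with input bound `ρ`. -/
noncomputable def Design.filterRate (S : Design n m p nz) (ρ : ℝ) : ℝ :=
  infNorm S.Az * (l1Norm S.Az S.Bz (1 : Matrix (Fin nz) (Fin nz) ℝ) * ρ) + infNorm S.Bz * ρ

/-- Bound on the rate of change of the lumped uncertainty. -/
noncomputable def Design.fBarRate (S : Design n m p nz) : ℝ :=
  infNorm S.Cz * S.filterRate S.fMax +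
    infNorm S.Dz * (S.d (S.ρx + 1) * S.xRate + S.b (S.ρx + 1))

/-- Bound on the rate of change of the state of the virtual system. -/
noncomputable def Design.xgRate (S : Design n m p nz) : ℝ :=
  S.xRate + S.ωu * (infNorm S.Tz * S.filterRate S.ρu) + infNorm S.Tz * S.filterRate S.fMax +
    S.filterRate S.ρu

section Nonneg

variable {S : Design n m p nz}

theorem Design.Admissible.ωu_pos (hS : S.Admissible) : 0 < S.ωu := hS.ωl_pos.trans hS.ωl_lt

theorem Design.Admissible.fMax_pos (hS : S.Admissible) : 0 < S.fMax :=
  add_pos (mul_pos hS.d_ρx_pos hS.ρx_pos) hS.b₀_pos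

theorem Design.filterRate_nonneg (S : Design n m p nz) {ρ : ℝ} (hρ : 0 ≤ ρ) :
    0 ≤ S.filterRate ρ :=
  add_nonneg (mul_nonneg (infNorm_nonneg _) (mul_nonneg (l1Norm_nonneg _ _ _) hρ))
    (mul_nonneg (infNorm_nonneg _) hρ)

theorem Design.Admissible.xRate_nonneg (hS : S.Admissible) : 0 ≤ S.xRate :=
  add_nonneg (mul_nonneg (infNorm_nonneg _) hS.ρx_pos.le)
    (mul_nonneg (infNorm_nonneg _)
      (add_nonneg (mul_nonneg hS.ωu_pos.le hS.ρu_pos.le) hS.fMax_pos.le))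

theorem Design.Admissible.fBarRate_nonneg (hS : S.Admissible) : 0 ≤ S.fBarRate := by
  have h : 0 < S.ρx + 1 := by linarith [hS.ρx_pos]
  exact add_nonneg (mul_nonneg (infNorm_nonneg _) (S.filterRate_nonneg hS.fMax_pos.le))
    (mul_nonneg (infNorm_nonneg _)
      (add_nonneg (mul_nonneg (hS.d_pos _ h).le hS.xRate_nonneg) (hS.b_pos _ h).le))

theorem Design.Admissible.xgRate_nonneg (hS : S.Admissible) : 0 ≤ S.xgRate := by
  have h1 := S.filterRate_nonneg hS.fMax_pos.le
  have h2 := S.filterRate_nonneg hS.ρu_pos.le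
  have h3 := infNorm_nonneg S.Tz
  have h4 := hS.xRate_nonneg
  have h5 := hS.ωu_pos
  rw [Design.xgRate]; positivity

end Nonneg

theorem filter_rate {S : Design n m p nz} (hS : S.Admissible) {z : ℝ → Fin nz → ℝ}
    {w : ℝ → Fin m → ℝ} {τ ρ : ℝ} (hz0 : z 0 = 0)
    (hz : ∀ t ∈ Icc 0 τ, HasDerivWithinAt z (S.Az *ᵥ z t + S.Bz *ᵥ w t) (Icc 0 τ) t)
    (hw : ContinuousOn w (Icc 0 τ)) (hρ : ∀ t ∈ Icc 0 τ, ‖w t‖ ≤ ρ) {t t' : ℝ}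
    (ht : t ∈ Icc 0 τ) (ht' : t' ∈ Icc 0 τ) : ‖z t - z t'‖ ≤ S.filterRate ρ * |t - t'| := by
  refine norm_sub_le_of_hasDerivWithinAt hz (fun r hr => ?_) ht ht'
  have := norm_output_le_l1Norm hS.Az_hurwitz S.Bz (1 : Matrix (Fin nz) (Fin nz) ℝ) hz0 hz hw hρ hr
  rw [one_mulVec] at this
  exact norm_linear_comb_le _ _ this (hρ r hr)

theorem norm_sum_elim_sub_le {a b : ℕ} (v v' : Fin a → ℝ) (w w' : Fin b → ℝ) :
    ‖(Sum.elim v w : Fin a ⊕ Fin b → ℝ) - Sum.elim v' w'‖ ≤ ‖v - v'‖ + ‖w - w'‖ := by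
  refine (pi_norm_le_iff_of_nonneg (by positivity)).2 fun i => ?_
  rcases i with i | i
  · have := norm_le_pi_norm (v - v') i
    simp only [Pi.sub_apply, Sum.elim_inl] at this ⊢
    linarith [norm_nonneg (w - w')]
  · have := norm_le_pi_norm (w - w') i
    simp only [Pi.sub_apply, Sum.elim_inr] at this ⊢
    linarith [norm_nonneg (v - v')]

theorem exists_rate_bounds {S : Design n m p nz} (hS : S.Admissible) {W : Unknowns n m}
    {K : Controller m mr nd} {s : Signals n m p nz nd} {τ : ℝ} (hW : W.Admissible S) (hτ : 0 < τ)
    (h : s.IsClosedLoop S W K τ) (hb : s.Bounded S τ) :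
    s.Parametrized S W τ (S.dBar * ((S.fBarRate + S.dBar * S.xgRate) / S.bBar))
      (S.bBar * ((S.fBarRate + S.dBar * S.xgRate) / S.bBar)) := by
  obtain ⟨xv, xf, hv⟩ := h.exists_isVirtual hS hW hτ
  have hX : ∀ t ∈ Icc 0 τ, S.Tg W.ω *ᵥ s.xg xv t + S.Tz *ᵥ xf t = s.x t :=
    fun t ht => hv.state_eq hS hW h ht
  have hfv : ∀ t ∈ Icc 0 τ, s.fv S W xv xf t = W.f (s.x t) t :=
    fun t ht => by rw [Signals.fv, hX t ht]
  have hω0 : 0 < W.ω := hS.ωl_pos.trans_le hW.ω_mem.1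
  have hFle : ∀ t ∈ Icc 0 τ, ‖W.f (s.x t) t‖ ≤ S.fMax := fun t ht =>
    (Unknowns.Admissible.norm_le hS hW (hb t ht).1 ht.1).trans
      (add_le_add_left (mul_le_mul_of_nonneg_left (hb t ht).1 hS.d_ρx_pos.le) _)
  have hFc := hW.continuousOn_comp h.continuousOn_x
  have hxf : ∀ t ∈ Icc 0 τ,
      HasDerivWithinAt xf (S.Az *ᵥ xf t + S.Bz *ᵥ W.f (s.x t) t) (Icc 0 τ) t :=
    fun t ht => by rw [← hfv t ht]; exact hv.xf_ode t ht
  have hfbar : ∀ t ∈ Icc 0 τ, ‖s.fBar S W xv xf t‖ ≤ S.dBar * ‖s.xg xv t‖ + S.bBar := by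
    intro t ht
    have h1 : S.Cz *ᵥ xf t =
        (S.Cz * leftInv S.Tz) *ᵥ s.x t - (S.Cz * leftInv S.Tz * S.Tg W.ω) *ᵥ s.xg xv t := by
      rw [← hX t ht, mulVec_add, mulVec_mulVec, mulVec_mulVec, add_sub_cancel_left,
        Matrix.mul_assoc, hS.leftInv_Tz, Matrix.mul_one]
    have h2 : ‖S.Cz *ᵥ xf t‖ ≤ infNorm (S.Cz * leftInv S.Tz) * S.ρx +
        infNorm (S.Cz * leftInv S.Tz * S.Tg W.ω) * ‖s.xg xv t‖ := by
      rw [h1]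
      exact (norm_sub_le _ _).trans (add_le_add ((norm_mulVec_le_infNorm _ _).trans
        (mul_le_mul_of_nonneg_left (hb t ht).1 (infNorm_nonneg _))) (norm_mulVec_le_infNorm _ _))
    have h3 : ‖S.Tz *ᵥ xf t‖ ≤ l1Norm S.Az S.Bz S.Tz * S.fMax :=
      norm_output_le_l1Norm hS.Az_hurwitz S.Bz S.Tz hv.xf_zero hxf hFc hFle ht
    have h4 : ‖s.x t‖ ≤ infNorm (S.Tg W.ω) * ‖s.xg xv t‖ + l1Norm S.Az S.Bz S.Tz * S.fMax := by
      rw [← hX t ht]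
      exact (norm_add_le _ _).trans (add_le_add (norm_mulVec_le_infNorm _ _) h3)
    have h5 : ‖W.f (s.x t) t‖ ≤ S.d S.ρx *
        (infNorm (S.Tg W.ω) * ‖s.xg xv t‖ + l1Norm S.Az S.Bz S.Tz * S.fMax) + S.b₀ :=
      (Unknowns.Admissible.norm_le hS hW (hb t ht).1 ht.1).trans
        (add_le_add_left (mul_le_mul_of_nonneg_left h4 hS.d_ρx_pos.le) _)
    have h6 : ‖S.Dz *ᵥ W.f (s.x t) t‖ ≤ infNorm S.Dz * (S.d S.ρx *
        (infNorm (S.Tg W.ω) * ‖s.xg xv t‖ + l1Norm S.Az S.Bz S.Tz * S.fMax) + S.b₀) :=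
      (norm_mulVec_le_infNorm _ _).trans (mul_le_mul_of_nonneg_left h5 (infNorm_nonneg _))
    have h7 := mul_le_mul_of_nonneg_right (S.le_dBar hW.ω_mem) (norm_nonneg (s.xg xv t))
    rw [Signals.fBar, hfv t ht]
    refine (norm_add_le _ _).trans ((add_le_add h2 h6).trans ?_)
    rw [Design.bBar]
    rw [Design.fMax]
    linarith
  have hux := fun t ht t' ht' => filter_rate hS (t := t) (t' := t') h.xu_zero h.xu_ode
    h.continuousOn_u (fun t ht => (hb t ht).2) ht ht'
  have hfx := fun t ht t' ht' => filter_rate hS (t := t) (t' := t') hv.xf_zero hxf hFc hFle ht ht'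
  have hxx : ∀ t ∈ Icc 0 τ, ∀ t' ∈ Icc 0 τ, ‖s.x t - s.x t'‖ ≤ S.xRate * |t - t'| := by
    intro t ht t' ht'
    refine norm_sub_le_of_hasDerivWithinAt h.x_ode (fun r hr => ?_) ht ht'
    refine norm_linear_comb_le _ _ (hb r hr).1 ((norm_add_le _ _).trans
      (add_le_add ?_ (hFle r hr)))
    rw [norm_smul, Real.norm_of_nonneg hω0.le]
    exact mul_le_mul hW.ω_mem.2 (hb r hr).2 (norm_nonneg _) hS.ωu_pos.le
  have hρ1 : ∀ t ∈ Icc 0 τ, ‖s.x t‖ < S.ρx + 1 := fun t ht => (hb t ht).1.trans_lt (by linarith)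
  have hfb : ∀ t ∈ Icc 0 τ, ∀ t' ∈ Icc 0 τ,
      ‖s.fBar S W xv xf t - s.fBar S W xv xf t'‖ ≤ S.fBarRate * |t - t'| := by
    intro t ht t' ht'
    have e : s.fBar S W xv xf t - s.fBar S W xv xf t' =
        S.Cz *ᵥ (xf t - xf t') + S.Dz *ᵥ (W.f (s.x t) t - W.f (s.x t') t') := by
      rw [Signals.fBar, Signals.fBar, hfv t ht, hfv t' ht', mulVec_sub, mulVec_sub]; abel
    rw [e]
    refine (norm_linear_comb_le _ _ (hfx t ht t' ht') (Unknowns.Admissible.norm_sub_le hS hW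
      (hρ1 t ht) (hρ1 t' ht') ht.1 ht'.1 (hxx t ht t' ht'))).trans (le_of_eq ?_)
    rw [Design.fBarRate]; ring
  have hxg : ∀ t ∈ Icc 0 τ, ∀ t' ∈ Icc 0 τ,
      ‖s.xg xv t - s.xg xv t'‖ ≤ S.xgRate * |t - t'| := by
    intro t ht t' ht'
    have e1 : ∀ r ∈ Icc 0 τ, xv r = s.x r - W.ω • (S.Tz *ᵥ s.xu r) - S.Tz *ᵥ xf r := by
      intro r hr
      rw [← hX r hr, Signals.xg, Design.Tg_mulVec_elim]; abel
    have e2 : xv t - xv t' = (s.x t - s.x t') - W.ω • (S.Tz *ᵥ (s.xu t - s.xu t')) -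
        S.Tz *ᵥ (xf t - xf t') := by
      rw [e1 t ht, e1 t' ht', mulVec_sub, mulVec_sub, smul_sub]; abel
    have h1 : ‖W.ω • (S.Tz *ᵥ (s.xu t - s.xu t'))‖ ≤
        S.ωu * (infNorm S.Tz * (S.filterRate S.ρu * |t - t'|)) := by
      rw [norm_smul, Real.norm_of_nonneg hω0.le]
      exact mul_le_mul hW.ω_mem.2 ((norm_mulVec_le_infNorm _ _).trans
        (mul_le_mul_of_nonneg_left (hux t ht t' ht') (infNorm_nonneg _))) (norm_nonneg _)
        hS.ωu_pos.le
    have h2 : ‖S.Tz *ᵥ (xf t - xf t')‖ ≤ infNorm S.Tz * (S.filterRate S.fMax * |t - t'|) :=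
      (norm_mulVec_le_infNorm _ _).trans
        (mul_le_mul_of_nonneg_left (hfx t ht t' ht') (infNorm_nonneg _))
    have h3 : ‖xv t - xv t'‖ ≤ S.xRate * |t - t'| +
        S.ωu * (infNorm S.Tz * (S.filterRate S.ρu * |t - t'|)) +
        infNorm S.Tz * (S.filterRate S.fMax * |t - t'|) := by
      rw [e2]
      exact (norm_sub_le _ _).trans (add_le_add ((norm_sub_le _ _).trans
        (add_le_add (hxx t ht t' ht') h1)) h2)
    have h4 := norm_sum_elim_sub_le (xv t) (xv t') (s.xu t) (s.xu t')
    have h5 := hux t ht t' ht'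
    rw [Signals.xg, Signals.xg, Design.xgRate]
    linarith
  rcases Nat.eq_zero_or_pos m with rfl | hm
  · have hr : 0 ≤ (S.fBarRate + S.dBar * S.xgRate) / S.bBar :=
      div_nonneg (add_nonneg hS.fBarRate_nonneg (mul_nonneg hS.dBar_nonneg hS.xgRate_nonneg))
        hS.bBar_nonneg
    refine ⟨xv, xf, 0, 0, hv, fun t _ => Subsingleton.elim _ _, fun t _ => ?_, fun t _ t' _ => ?_⟩
    · simp only [Pi.zero_apply, norm_zero]
      exact ⟨hS.dBar_nonneg, hS.bBar_nonneg⟩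
    · simp only [Pi.zero_apply, sub_self, norm_zero]
      exact ⟨mul_nonneg (mul_nonneg hS.dBar_nonneg hr) (abs_nonneg _),
        mul_nonneg (mul_nonneg hS.bBar_nonneg hr) (abs_nonneg _)⟩
  have hβ := hS.bBar_pos hm
  set D : ℝ → ℝ := fun t => S.dBar * ‖s.xg xv t‖ + S.bBar with hD
  have hDβ : ∀ t, S.bBar ≤ D t := fun t =>
    le_add_of_nonneg_left (mul_nonneg hS.dBar_nonneg (norm_nonneg _))
  have hD0 : ∀ t, 0 < D t := fun t => hβ.trans_le (hDβ t)
  have hDl : ∀ t ∈ Icc 0 τ, ∀ t' ∈ Icc 0 τ,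
      |D t - D t'| ≤ S.dBar * S.xgRate * |t - t'| := by
    intro t ht t' ht'
    have e : D t - D t' = S.dBar * (‖s.xg xv t‖ - ‖s.xg xv t'‖) := by simp only [hD]; ring
    rw [e, abs_mul, abs_of_nonneg hS.dBar_nonneg, mul_assoc]
    exact mul_le_mul_of_nonneg_left ((abs_norm_sub_norm_le _ _).trans (hxg t ht t' ht'))
      hS.dBar_nonneg
  have hbd : ∀ γ, 0 ≤ γ → ∀ t ∈ Icc 0 τ, ‖(γ / D t) • s.fBar S W xv xf t‖ ≤ γ := by
    intro γ hγ t ht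
    rw [norm_smul, Real.norm_of_nonneg (div_nonneg hγ (hD0 t).le), div_mul_eq_mul_div,
      div_le_iff₀ (hD0 t)]
    exact mul_le_mul_of_nonneg_left (hfbar t ht) hγ
  refine ⟨xv, xf, fun t => (S.dBar / D t) • s.fBar S W xv xf t,
    fun t => (S.bBar / D t) • s.fBar S W xv xf t, hv, fun t _ => ?_,
    fun t ht => ⟨hbd _ hS.dBar_nonneg t ht, hbd _ hS.bBar_nonneg t ht⟩, fun t ht t' ht' =>
    ⟨norm_div_smul_sub_le hβ (hDβ t) (hD0 t') (hfbar t' ht') (hfb t ht t' ht') (hDl t ht t' ht') _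
      hS.dBar_nonneg, norm_div_smul_sub_le hβ (hDβ t) (hD0 t') (hfbar t' ht') (hfb t ht t' ht')
      (hDl t ht t' ht') _ hS.bBar_nonneg⟩⟩
  rw [smul_smul, ← add_smul]
  have : ‖s.xg xv t‖ * (S.dBar / D t) + S.bBar / D t = 1 := by
    have := (hD0 t).ne'
    field_simp
    simp only [hD]; ring
  rw [this, one_smul]

end Rates

/-! ### The energy of the estimation errors -/

section Energy

variable {n m p nz : ℕ} {S : Design n m p nz}

theorem Design.Admissible.lambdaMin_Qv_pos (hS : S.Admissible) : 0 < lambdaMin S.Qv :=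
  lambdaMin_sub_smul_one_pos hS.n_pos hS.Q_pos.isHermitian hS.εq_lt

theorem Design.Admissible.lam₁_pos (hS : S.Admissible) : 0 < S.lam₁ :=
  lt_min (div_pos hS.lambdaMin_Qv_pos (lambdaMax_pos hS.n_pos hS.Pv_pos)) hS.αy_pos

theorem transpose_mulVec_dotProduct {ι κ : Type} [Fintype ι] [Fintype κ] (M : Matrix ι κ ℝ)
    (a : ι → ℝ) (b : κ → ℝ) : (Mᵀ *ᵥ a) ⬝ᵥ b = a ⬝ᵥ (M *ᵥ b) := by
  rw [mulVec_transpose, dotProduct_mulVec]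

theorem two_mul_le_of_sq_le {x A B ε : ℝ} (hε : 0 < ε) (hA : 0 ≤ A) (hB : 0 ≤ B)
    (h : x ^ 2 ≤ A * B) : 2 * x ≤ ε * A + B / ε := by
  refine le_of_sq_le_sq ?_ (by positivity)
  have e : (ε * A + B / ε) ^ 2 = (ε * A - B / ε) ^ 2 + 4 * (A * B) := by
    field_simp; ring
  rw [e]
  nlinarith [sq_nonneg (ε * A - B / ε)]

theorem Design.Admissible.dotProduct_Qv_ge (hS : S.Admissible) (e : Fin n → ℝ) :
    S.lam₁ * (e ⬝ᵥ (S.Pv *ᵥ e)) ≤ e ⬝ᵥ (S.Qv *ᵥ e) := by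
  have hmax := lambdaMax_pos hS.n_pos hS.Pv_pos
  have hQv : S.Qv.IsHermitian :=
    hS.Q_pos.isHermitian.sub ((isHermitian_one).smul (by simp [IsSelfAdjoint]))
  have h1 := lambdaMin_mul_dotProduct_le hQv e
  have h2 := dotProduct_le_lambdaMax_mul hS.Pv_pos.isHermitian e
  calc S.lam₁ * (e ⬝ᵥ (S.Pv *ᵥ e)) ≤ S.lam₁ * (lambdaMax S.Pv * (e ⬝ᵥ e)) :=
        mul_le_mul_of_nonneg_left h2 hS.lam₁_pos.le
    _ ≤ lambdaMin S.Qv / lambdaMax S.Pv * (lambdaMax S.Pv * (e ⬝ᵥ e)) :=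
        mul_le_mul_of_nonneg_right (min_le_left _ _)
          (mul_nonneg hmax.le (zero_le_dotProduct_self e))
    _ = lambdaMin S.Qv * (e ⬝ᵥ e) := by field_simp
    _ ≤ _ := h1

theorem Design.Admissible.transpose_Pv (hS : S.Admissible) : S.Pvᵀ = S.Pv :=
  (conjTranspose_eq_transpose_of_trivial _).symm.trans hS.Pv_pos.isHermitian

theorem Design.Admissible.transpose_Py (hS : S.Admissible) : S.Pyᵀ = S.Py :=
  (conjTranspose_eq_transpose_of_trivial _).symm.trans hS.Py_pos.isHermitian

theorem Design.Admissible.dotProduct_Av (hS : S.Admissible) (e : Fin n → ℝ) :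
    2 * (e ⬝ᵥ (S.Pv *ᵥ (S.Av *ᵥ e))) = -(e ⬝ᵥ (S.Q *ᵥ e)) := by
  have h1 : e ⬝ᵥ ((S.Avᵀ * S.Pv) *ᵥ e) = e ⬝ᵥ (S.Pv *ᵥ (S.Av *ᵥ e)) := by
    rw [← mulVec_mulVec, dotProduct_comm, transpose_mulVec_dotProduct,
      ← transpose_mulVec_dotProduct S.Pv, hS.transpose_Pv]
  have h2 := congrArg (fun M => e ⬝ᵥ (M *ᵥ e)) hS.lyapunov
  simp only [add_mulVec, dotProduct_add, neg_mulVec, dotProduct_neg, h1] at h2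
  rw [← mulVec_mulVec] at h2
  linarith

/-- The mismatch of the regressor norms is dominated by the quadratic margins of the design. -/
theorem Design.Admissible.two_mul_mismatch_le (hS : S.Admissible) {e : Fin n → ℝ}
    {yt : Fin p → ℝ} {θ : Fin m → ℝ} {δ : ℝ} (hθ : ‖θ‖ ≤ S.dBar) (hδ : |δ| ≤ ‖e‖) :
    2 * (δ * (yt ⬝ᵥ (S.Py *ᵥ ((S.Cm * S.Bbar) *ᵥ θ)))) ≤
      S.εq * (e ⬝ᵥ e) + S.αφ * (yt ⬝ᵥ (S.Py *ᵥ yt)) := by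
  set a := S.sqrtPy *ᵥ yt with ha
  set b := (S.sqrtPy * S.Cm * S.Bbar) *ᵥ θ with hb
  have hy : yt ⬝ᵥ (S.Py *ᵥ yt) = a ⬝ᵥ a := by
    rw [← hS.sqrtPy_sq, ← mulVec_mulVec, dotProduct_comm, transpose_mulVec_dotProduct]
  have hx : yt ⬝ᵥ (S.Py *ᵥ ((S.Cm * S.Bbar) *ᵥ θ)) = a ⬝ᵥ b := by
    rw [← hS.sqrtPy_sq, ← mulVec_mulVec, dotProduct_comm, transpose_mulVec_dotProduct,
      dotProduct_comm, mulVec_mulVec, ← Matrix.mul_assoc]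
  have hθ2 : θ ⬝ᵥ θ ≤ m * S.dBar ^ 2 :=
    (dotProduct_self_le_card_mul_norm_sq θ).trans (mul_le_mul_of_nonneg_left
      (pow_le_pow_left₀ (norm_nonneg _) hθ 2) (Nat.cast_nonneg _))
  have hbb : b ⬝ᵥ b ≤ twoNorm (S.sqrtPy * S.Cm * S.Bbar) ^ 2 * (m * S.dBar ^ 2) :=
    (dotProduct_mulVec_self_le_twoNorm _ θ).trans
      (mul_le_mul_of_nonneg_left hθ2 (sq_nonneg _))
  have ha0 := zero_le_dotProduct_self a
  have hb0 := zero_le_dotProduct_self b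
  have hab : (a ⬝ᵥ b) ^ 2 ≤ (a ⬝ᵥ a) * (b ⬝ᵥ b) := by
    have := pow_le_pow_left₀ (abs_nonneg _) (abs_dotProduct_le_sqrt a b) 2
    rwa [sq_abs, mul_pow, Real.sq_sqrt ha0, Real.sq_sqrt hb0] at this
  have hδ2 : δ ^ 2 ≤ e ⬝ᵥ e := by
    rw [← sq_abs]
    exact (pow_le_pow_left₀ (abs_nonneg _) hδ 2).trans (norm_sq_le_dotProduct_self e)
  have hsq : (δ * (a ⬝ᵥ b)) ^ 2 ≤ (e ⬝ᵥ e) *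
      ((a ⬝ᵥ a) * (twoNorm (S.sqrtPy * S.Cm * S.Bbar) ^ 2 * (m * S.dBar ^ 2))) := by
    rw [mul_pow]
    exact mul_le_mul hδ2 (hab.trans (mul_le_mul_of_nonneg_left hbb ha0)) (sq_nonneg _)
      (zero_le_dotProduct_self e)
  rw [hx, hy]
  refine (two_mul_le_of_sq_le hS.εq_pos (zero_le_dotProduct_self e) ?_ hsq).trans (le_of_eq ?_)
  · positivity
  · rw [Design.αφ]; ring

/-- The derivative of the energy of the estimation errors along the error dynamics. -/
theorem Design.Admissible.energy_rate_le (hS : S.Admissible) {e : Fin n → ℝ} {yt : Fin p → ℝ}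
    {w θ : Fin m → ℝ} {δ : ℝ} (hθ : ‖θ‖ ≤ S.dBar) (hδ : |δ| ≤ ‖e‖) :
    2 * (e ⬝ᵥ (S.Pv *ᵥ (S.Av *ᵥ e - (S.Pv⁻¹ * S.Amᵀ * S.Cmᵀ * S.Py) *ᵥ yt))) +
      2 * (yt ⬝ᵥ (S.Py *ᵥ (-(S.α • yt) + (S.Cm * S.Am) *ᵥ e +
        (S.Cm * S.Bbar) *ᵥ (w + δ • θ)))) ≤
      -S.lam₁ * (e ⬝ᵥ (S.Pv *ᵥ e) + yt ⬝ᵥ (S.Py *ᵥ yt)) +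
        2 * (((S.Bbarᵀ * S.Cmᵀ * S.Py) *ᵥ yt) ⬝ᵥ w) := by
  have hPv : S.Pv * S.Pv⁻¹ = 1 := mul_nonsing_inv _ ((isUnit_iff_isUnit_det _).1 hS.Pv_pos.isUnit)
  have h1 : e ⬝ᵥ (S.Pv *ᵥ ((S.Pv⁻¹ * S.Amᵀ * S.Cmᵀ * S.Py) *ᵥ yt)) =
      yt ⬝ᵥ (S.Py *ᵥ ((S.Cm * S.Am) *ᵥ e)) := by
    have : S.Pv * (S.Pv⁻¹ * S.Amᵀ * S.Cmᵀ * S.Py) = (S.Cm * S.Am)ᵀ * S.Py := by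
      simp only [← Matrix.mul_assoc, hPv, Matrix.one_mul, transpose_mul]
    rw [mulVec_mulVec, this, ← mulVec_mulVec, dotProduct_comm, transpose_mulVec_dotProduct,
      ← transpose_mulVec_dotProduct S.Py, hS.transpose_Py]
  have h2 : yt ⬝ᵥ (S.Py *ᵥ ((S.Cm * S.Bbar) *ᵥ w)) =
      ((S.Bbarᵀ * S.Cmᵀ * S.Py) *ᵥ yt) ⬝ᵥ w := by
    rw [← transpose_mul, ← mulVec_mulVec yt, transpose_mulVec_dotProduct,
      ← transpose_mulVec_dotProduct S.Py, hS.transpose_Py]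
  have h3 := hS.two_mul_mismatch_le (yt := yt) hθ hδ
  have h4 := hS.dotProduct_Av e
  have h5 := hS.dotProduct_Qv_ge e
  have h6 : e ⬝ᵥ (S.Qv *ᵥ e) = e ⬝ᵥ (S.Q *ᵥ e) - S.εq * (e ⬝ᵥ e) := by
    rw [Design.Qv, sub_mulVec, dotProduct_sub, smul_mulVec, one_mulVec, dotProduct_smul,
      smul_eq_mul]
  have h7 : S.lam₁ * (yt ⬝ᵥ (S.Py *ᵥ yt)) ≤ S.αy * (yt ⬝ᵥ (S.Py *ᵥ yt)) :=
    mul_le_mul_of_nonneg_right (min_le_right _ _)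
      (by simpa using hS.Py_pos.posSemidef.dotProduct_mulVec_nonneg yt)
  rw [Design.αy] at h7
  simp only [mulVec_add, mulVec_sub, mulVec_neg, mulVec_smul, dotProduct_add, dotProduct_sub,
    dotProduct_neg, dotProduct_smul, smul_eq_mul, h1, h2]
  linarith

end Energy

/-! ### Error dynamics -/

section ErrorDynamics

variable {n m p nz mr nd : ℕ} {S : Design n m p nz} {W : Unknowns n m} {K : Controller m mr nd}
  {s : Signals n m p nz nd} {τ : ℝ} {xv : ℝ → Fin n → ℝ} {xf : ℝ → Fin nz → ℝ}

theorem hasDerivWithinAt_output (hS : S.Admissible) (hW : W.Admissible S)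
    (h : s.IsClosedLoop S W K τ) (hv : s.IsVirtual S W τ xv xf) {t : ℝ} (ht : t ∈ Icc 0 τ) :
    HasDerivWithinAt (s.y S) ((S.Cm * S.Am) *ᵥ xv t +
      (S.Cm * S.Bbar) *ᵥ (W.ω • s.uz S t + s.fBar S W xv xf t)) (Icc 0 τ) t := by
  have hx := hv.state_eq hS hW h ht
  refine (hasDerivWithinAt_const_mulVec S.Cm (h.x_ode t ht)).congr_deriv ?_
  rw [Signals.fBar, Signals.fv, hx, Signals.uz, ← hS.output_field_eq, ← hx, Signals.xg,
    Design.Tg_mulVec_elim]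

theorem output_eq (hS : S.Admissible) (hW : W.Admissible S)
    (h : s.IsClosedLoop S W K τ) (hv : s.IsVirtual S W τ xv xf) {t : ℝ} (ht : t ∈ Icc 0 τ) :
    s.y S t = S.Cm *ᵥ xv t := by
  rw [Signals.y, ← hv.state_eq hS hW h ht, Signals.xg, Design.Tg_mulVec_elim]
  simp [mulVec_add, mulVec_smul, mulVec_mulVec, hS.CmTz]

theorem hasDerivWithinAt_stateError (hS : S.Admissible) (hW : W.Admissible S)
    (h : s.IsClosedLoop S W K τ) (hv : s.IsVirtual S W τ xv xf) {t : ℝ} (ht : t ∈ Icc 0 τ) :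
    HasDerivWithinAt (fun t => s.xvHat S t - xv t)
      (S.Av *ᵥ (s.xvHat S t - xv t) - (S.Pv⁻¹ * S.Amᵀ * S.Cmᵀ * S.Py) *ᵥ s.yTilde S t)
      (Icc 0 τ) t := by
  refine (((h.vHat_ode t ht).fun_add (hasDerivWithinAt_const_mulVec S.H
    (hasDerivWithinAt_output hS hW h hv ht))).fun_sub (hv.xv_ode t ht)).congr_deriv ?_
  have h1 : S.H *ᵥ ((S.Cm * S.Bbar) *ᵥ (W.ω • s.uz S t + s.fBar S W xv xf t)) =
      S.Bbar *ᵥ (W.ω • s.uz S t + s.fBar S W xv xf t) := by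
    rw [mulVec_mulVec, hS.H_mul_Cm_mul_Bbar]
  have h2 : S.Av *ᵥ xv t = S.Am *ᵥ xv t - S.H *ᵥ ((S.Cm * S.Am) *ᵥ xv t) +
      S.Kv *ᵥ (S.Cm *ᵥ xv t) := by
    rw [Design.Av, Design.AH, add_mulVec, Matrix.sub_mul, sub_mulVec, Matrix.one_mul,
      mulVec_mulVec, mulVec_mulVec, Matrix.mul_assoc]
  rw [mulVec_add, h1, mulVec_sub S.Av, h2, output_eq hS hW h hv ht]
  abel

/-- The part of the input-estimation error that the adaptive laws act on. -/
noncomputable def paramError (s : Signals n m p nz nd) (S : Design n m p nz) (W : Unknowns n m)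
    (θ σ : ℝ → Fin m → ℝ) (t : ℝ) : Fin m → ℝ :=
  (s.ωHat t - W.ω) • s.uz S t + ‖s.xgHat S t‖ • (s.θHat t - θ t) + (s.σHat t - σ t)

theorem hasDerivWithinAt_yTilde (hS : S.Admissible) (hW : W.Admissible S)
    (h : s.IsClosedLoop S W K τ) (hv : s.IsVirtual S W τ xv xf) {θ σ : ℝ → Fin m → ℝ} {t : ℝ}
    (ht : t ∈ Icc 0 τ) (hf : s.fBar S W xv xf t = ‖s.xg xv t‖ • θ t + σ t) :
    HasDerivWithinAt (s.yTilde S)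
      (-(S.α • s.yTilde S t) + (S.Cm * S.Am) *ᵥ (s.xvHat S t - xv t) +
        (S.Cm * S.Bbar) *ᵥ (paramError s S W θ σ t +
          (‖s.xgHat S t‖ - ‖s.xg xv t‖) • θ t)) (Icc 0 τ) t := by
  refine ((h.yHat_ode t ht).fun_sub (hasDerivWithinAt_output hS hW h hv ht)).congr_deriv ?_
  have h1 : paramError s S W θ σ t + (‖s.xgHat S t‖ - ‖s.xg xv t‖) • θ t =
      s.ηHat S t - (W.ω • s.uz S t + s.fBar S W xv xf t) := by
    rw [hf, paramError, Signals.ηHat]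
    module
  rw [h1, mulVec_sub, mulVec_sub]
  abel

end ErrorDynamics

/-! ### Majorants for drifting parameters -/

section Majorant

variable {k : ℕ}

theorem sqrt_dotProduct_self_eq_norm (v : Fin k → ℝ) :
    √(v ⬝ᵥ v) = ‖(WithLp.toLp 2 v : EuclideanSpace ℝ (Fin k))‖ := by
  rw [dotProduct_self_eq_norm_sq, Real.sqrt_sq (norm_nonneg _)]

theorem sqrt_dotProduct_self_le_sqrt_mul_norm (v : Fin k → ℝ) : √(v ⬝ᵥ v) ≤ √k * ‖v‖ := by
  rw [← Real.sqrt_sq (norm_nonneg v), ← Real.sqrt_mul (Nat.cast_nonneg k)]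
  exact Real.sqrt_le_sqrt (dotProduct_self_le_card_mul_norm_sq v)

theorem dotProduct_sub_self_le {a θ θ' : Fin k → ℝ} {M L : ℝ}
    (hM : √((a - θ) ⬝ᵥ (a - θ)) ≤ M) (hL : √((θ - θ') ⬝ᵥ (θ - θ')) ≤ L) :
    (a - θ') ⬝ᵥ (a - θ') ≤ (a - θ) ⬝ᵥ (a - θ) + 2 * M * L + L ^ 2 := by
  rw [sqrt_dotProduct_self_eq_norm] at hM hL
  rw [dotProduct_self_eq_norm_sq, dotProduct_self_eq_norm_sq]
  have e : (WithLp.toLp 2 (a - θ') : EuclideanSpace ℝ (Fin k)) =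
      WithLp.toLp 2 (a - θ) + WithLp.toLp 2 (θ - θ') := by
    rw [← WithLp.toLp_add, sub_add_sub_cancel]
  have h1 : ‖(WithLp.toLp 2 (a - θ') : EuclideanSpace ℝ (Fin k))‖ ≤
      ‖(WithLp.toLp 2 (a - θ) : EuclideanSpace ℝ (Fin k))‖ + L := by
    rw [e]
    exact (norm_add_le _ _).trans (by linarith)
  have hL0 : 0 ≤ L := (norm_nonneg _).trans hL
  have h2 := pow_le_pow_left₀ (norm_nonneg _) h1 2
  have h3 := mul_le_mul_of_nonneg_right hM hL0
  nlinarith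

theorem hasDerivWithinAt_majorant {θh : ℝ → Fin k → ℝ} {θh' θ : Fin k → ℝ} {M L x : ℝ}
    {s : Set ℝ} (h : HasDerivWithinAt θh θh' s x) :
    HasDerivWithinAt (fun z => (θh z - θ) ⬝ᵥ (θh z - θ) + 2 * M * (L * (z - x)) + (L * (z - x)) ^ 2)
      (2 * ((θh x - θ) ⬝ᵥ θh') + 2 * M * L) s x := by
  have h1 := hasDerivWithinAt_dotProduct (h.sub_const θ) (h.sub_const θ)
  have h2 : HasDerivWithinAt (fun z => L * (z - x)) L s x := by
    simpa using ((hasDerivWithinAt_id x s).sub_const x).const_mul L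
  refine ((h1.fun_add (h2.const_mul (2 * M))).fun_add (h2.fun_pow 2)).congr_deriv ?_
  rw [dotProduct_comm θh']
  simp
  ring

theorem sqrt_dotProduct_sub_le {θh θ : Fin k → ℝ} {ε R : ℝ} (hε : 0 ≤ ε) (hR : 0 ≤ R)
    (h1 : θh ⬝ᵥ θh ≤ (1 + ε) * R ^ 2) (h2 : θ ⬝ᵥ θ ≤ R ^ 2) :
    √((θh - θ) ⬝ᵥ (θh - θ)) ≤ (2 + ε) * R := by
  rw [sqrt_dotProduct_self_eq_norm]
  rw [dotProduct_self_eq_norm_sq] at h1 h2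
  have h3 : ‖(WithLp.toLp 2 θ : EuclideanSpace ℝ (Fin k))‖ ≤ R :=
    (pow_le_pow_iff_left₀ (norm_nonneg _) hR two_ne_zero).1 h2
  have h4 : ‖(WithLp.toLp 2 θh : EuclideanSpace ℝ (Fin k))‖ ≤ (1 + ε) * R := by
    refine (pow_le_pow_iff_left₀ (norm_nonneg _) (by positivity) two_ne_zero).1 (h1.trans ?_)
    rw [mul_pow]
    refine mul_le_mul_of_nonneg_right ?_ (sq_nonneg R)
    nlinarith
  rw [WithLp.toLp_sub]
  refine (norm_sub_le _ _).trans ?_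
  linarith

end Majorant

/-! ### The Lyapunov function of the adaptive loop -/

section Lyapunov

variable {n m p nz mr nd : ℕ} {S : Design n m p nz}

/-- The tolerance of the projections is small enough for the drift of the Lyapunov function to be
dominated by `θ₁`. -/
theorem Design.Admissible.exists_tolerance (hS : S.Admissible) {lθ lσ : ℝ} (hlθ : 0 ≤ lθ)
    (hlσ : 0 ≤ lσ) : ∃ ε₀ > 0, ∀ ε, 0 < ε → ε ≤ ε₀ →
      ((2 + ε) * ((S.ωu - S.ωl) / 2)) ^ 2 + ((2 + ε) * (√m * S.dBar)) ^ 2 +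
        ((2 + ε) * (√m * S.bBar)) ^ 2 +
        2 / S.lam₁ * ((2 + ε) * (√m * S.dBar) * (√m * lθ) + (2 + ε) * (√m * S.bBar) * (√m * lσ)) ≤
      S.θ₁ lθ lσ := by
  have hlam := hS.lam₁_pos
  have hd := hS.dBar_nonneg
  have hb := hS.bBar_nonneg
  have hu := hS.ωu_pos
  have hm : √(m : ℝ) * √m = m := Real.mul_self_sqrt (Nat.cast_nonneg m)
  have hm0 : (0 : ℝ) ≤ m := Nat.cast_nonneg m
  set r := (S.ωu - S.ωl) / 2 with hr
  set q := r ^ 2 + m * S.dBar ^ 2 + m * S.bBar ^ 2 with hq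
  set g := m * ((S.dBar * lθ + S.bBar * lσ) / S.lam₁) with hg
  have hq0 : 0 ≤ q := by positivity
  have hg0 : 0 ≤ g := by positivity
  refine ⟨min 1 (3 * S.ωu ^ 2 / (5 * q + 2 * g + 1)), by positivity, fun ε hε hεle => ?_⟩
  have h1 : ε ≤ 1 := hεle.trans (min_le_left _ _)
  have h2 : ε * (5 * q + 2 * g + 1) ≤ 3 * S.ωu ^ 2 :=
    (le_div_iff₀ (by positivity)).1 (hεle.trans (min_le_right _ _))
  have h3 : ((2 + ε) * r) ^ 2 + ((2 + ε) * (√m * S.dBar)) ^ 2 + ((2 + ε) * (√m * S.bBar)) ^ 2 +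
      2 / S.lam₁ * ((2 + ε) * (√m * S.dBar) * (√m * lθ) + (2 + ε) * (√m * S.bBar) * (√m * lσ)) =
      (2 + ε) ^ 2 * q + (2 + ε) * (2 * g) := by
    calc _ = (2 + ε) ^ 2 * (r ^ 2 + (√m * √m) * S.dBar ^ 2 + (√m * √m) * S.bBar ^ 2) +
          (2 + ε) * (2 * ((√m * √m) * ((S.dBar * lθ + S.bBar * lσ) / S.lam₁))) := by ring
      _ = _ := by rw [hm]
  have h4 : S.θ₁ lθ lσ = 4 * q + 4 * g + 4 * (S.ωu ^ 2 - r ^ 2) := by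
    rw [Design.θ₁, Design.θ₀, hq, hg]; ring
  have h5 : r ^ 2 ≤ S.ωu ^ 2 / 4 := by
    have h6 : 0 ≤ r := by rw [hr]; linarith [hS.ωl_lt]
    have h7 : r ≤ S.ωu / 2 := by rw [hr]; linarith [hS.ωl_pos]
    nlinarith
  have h8 : ε ^ 2 * q ≤ ε * q := mul_le_mul_of_nonneg_right (by nlinarith) hq0
  rw [h3, h4]
  nlinarith

/-- The Lyapunov function: the energy of the estimation errors plus the weighted squares of the
parameter errors. -/
noncomputable def lyapunovFn (s : Signals n m p nz nd) (S : Design n m p nz) (W : Unknowns n m)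
    (K : Controller m mr nd) (xv : ℝ → Fin n → ℝ) (θ σ : ℝ → Fin m → ℝ) (t : ℝ) : ℝ :=
  (s.xvHat S t - xv t) ⬝ᵥ (S.Pv *ᵥ (s.xvHat S t - xv t)) +
    s.yTilde S t ⬝ᵥ (S.Py *ᵥ s.yTilde S t) + (s.ωHat t - W.ω) ^ 2 / K.Γω +
    (s.θHat t - θ t) ⬝ᵥ (s.θHat t - θ t) / K.Γθ + (s.σHat t - σ t) ⬝ᵥ (s.σHat t - σ t) / K.Γσ

theorem continuousOn_of_norm_sub_le {E : Type*} [NormedAddCommGroup E] {z : ℝ → E} {T : Set ℝ}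
    {l : ℝ} (hl : 0 ≤ l) (h : ∀ t ∈ T, ∀ t' ∈ T, ‖z t - z t'‖ ≤ l * |t - t'|) :
    ContinuousOn z T :=
  (LipschitzOnWith.of_dist_le_mul (K := NNReal.mk l hl) fun t ht t' ht' => by
    rw [dist_eq_norm, Real.dist_eq]; exact h t ht t' ht').continuousOn

theorem Controller.Admissible.Γ_pos {K : Controller m mr nd} (hK : K.Admissible S) : 0 < K.Γ :=
  lt_min hK.Γω_pos (lt_min hK.Γθ_pos hK.Γσ_pos)

theorem Controller.Γ_le_Γω (K : Controller m mr nd) : K.Γ ≤ K.Γω := min_le_left _ _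

theorem Controller.Γ_le_Γθ (K : Controller m mr nd) : K.Γ ≤ K.Γθ :=
  (min_le_right _ _).trans (min_le_left _ _)

theorem Controller.Γ_le_Γσ (K : Controller m mr nd) : K.Γ ≤ K.Γσ :=
  (min_le_right _ _).trans (min_le_right _ _)

theorem dotProduct_self_le_sq_of_norm_le {v : Fin m → ℝ} {r : ℝ} (h : ‖v‖ ≤ r) :
    v ⬝ᵥ v ≤ (√m * r) ^ 2 := by
  rw [mul_pow, Real.sq_sqrt (Nat.cast_nonneg m)]
  exact (dotProduct_self_le_card_mul_norm_sq v).trans (mul_le_mul_of_nonneg_left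
    (pow_le_pow_left₀ (norm_nonneg _) h 2) (Nat.cast_nonneg _))

theorem lyapunovFn_le {W : Unknowns n m} {K : Controller m mr nd} {s : Signals n m p nz nd}
    {τ lθ lσ : ℝ} (hS : S.Admissible) (hW : W.Admissible S) (hK : K.Admissible S)
    (h : s.IsClosedLoop S W K τ) (hlθ : 0 ≤ lθ) (hlσ : 0 ≤ lσ)
    (htol : ((2 + K.ε) * ((S.ωu - S.ωl) / 2)) ^ 2 + ((2 + K.ε) * (√m * S.dBar)) ^ 2 +
        ((2 + K.ε) * (√m * S.bBar)) ^ 2 + 2 / S.lam₁ * ((2 + K.ε) * (√m * S.dBar) * (√m * lθ) +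
          (2 + K.ε) * (√m * S.bBar) * (√m * lσ)) ≤ S.θ₁ lθ lσ)
    {xv : ℝ → Fin n → ℝ} {xf : ℝ → Fin nz → ℝ} {θ σ : ℝ → Fin m → ℝ}
    (hv : s.IsVirtual S W τ xv xf)
    (hf : ∀ t ∈ Icc 0 τ, s.fBar S W xv xf t = ‖s.xg xv t‖ • θ t + σ t)
    (hbd : ∀ t ∈ Icc 0 τ, ‖θ t‖ ≤ S.dBar ∧ ‖σ t‖ ≤ S.bBar)
    (hlip : ∀ t ∈ Icc 0 τ, ∀ t' ∈ Icc 0 τ,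
      ‖θ t - θ t'‖ ≤ lθ * |t - t'| ∧ ‖σ t - σ t'‖ ≤ lσ * |t - t'|) {t : ℝ} (ht : t ∈ Icc 0 τ) :
    lyapunovFn s S W K xv θ σ t ≤ S.θ₁ lθ lσ / K.Γ +
      n * lambdaMax S.PvBar * ‖W.x₀‖ ^ 2 * Real.exp (-S.lam₁ * t) := by
  have hε := hK.ε_pos
  have hΓ := hK.Γ_pos
  have hΓω := hK.Γω_pos
  have hΓθ := hK.Γθ_pos
  have hΓσ := hK.Γσ_pos
  have hlam := hS.lam₁_pos
  have hr : 0 < (S.ωu - S.ωl) / 2 := by linarith [hS.ωl_lt]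
  have hRθ : 0 ≤ √m * S.dBar := mul_nonneg (Real.sqrt_nonneg _) hS.dBar_nonneg
  have hRσ : 0 ≤ √m * S.bBar := mul_nonneg (Real.sqrt_nonneg _) hS.bBar_nonneg
  have hRθ' : 0 < √m * S.dBar ∨ m = 0 := by
    rcases Nat.eq_zero_or_pos m with hm | hm
    · exact Or.inr hm
    · exact Or.inl (mul_pos (Real.sqrt_pos.2 (Nat.cast_pos.2 hm)) (hS.dBar_pos hm))
  have hRσ' : 0 < √m * S.bBar ∨ m = 0 := by
    rcases Nat.eq_zero_or_pos m with hm | hm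
    · exact Or.inr hm
    · exact Or.inl (mul_pos (Real.sqrt_pos.2 (Nat.cast_pos.2 hm)) (hS.bBar_pos hm))
  set Mω := (2 + K.ε) * ((S.ωu - S.ωl) / 2) with hMω
  set Mθ := (2 + K.ε) * (√m * S.dBar) with hMθ
  set Mσ := (2 + K.ε) * (√m * S.bBar) with hMσ
  set Lθ := √m * lθ with hLθ
  set Lσ := √m * lσ with hLσ
  have hMθ0 : 0 ≤ Mθ := by positivity
  have hMσ0 : 0 ≤ Mσ := by positivity
  have hLθ0 : 0 ≤ Lθ := by positivity
  have hLσ0 : 0 ≤ Lσ := by positivity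
  have hωc : |W.ω - (S.ωl + S.ωu) / 2| ≤ (S.ωu - S.ωl) / 2 := by
    rw [abs_le]; constructor <;> linarith [hW.ω_mem.1, hW.ω_mem.2]
  have hθθ : ∀ z ∈ Icc 0 τ, θ z ⬝ᵥ θ z ≤ (√m * S.dBar) ^ 2 := fun z hz =>
    dotProduct_self_le_sq_of_norm_le (hbd z hz).1
  have hσσ : ∀ z ∈ Icc 0 τ, σ z ⬝ᵥ σ z ≤ (√m * S.bBar) ^ 2 := fun z hz =>
    dotProduct_self_le_sq_of_norm_le (hbd z hz).2
  have hωe : ∀ z ∈ Icc 0 τ, (s.ωHat z - W.ω) ^ 2 ≤ Mω ^ 2 := by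
    intro z hz
    have h1 := abs_sub_le_of_smoothProj_ode hε hr hΓω (c := (S.ωl + S.ωu) / 2) (by
      rw [h.ωHat_zero, abs_le]; constructor <;> linarith [hS.one_mem.1, hS.one_mem.2])
      h.ωHat_ode hz
    have h2 : |s.ωHat z - (S.ωl + S.ωu) / 2| ≤ (1 + K.ε) * ((S.ωu - S.ωl) / 2) := by
      refine abs_le_of_sq_le_sq (h1.trans ?_) (by positivity)
      rw [mul_pow]
      exact mul_le_mul_of_nonneg_right (by nlinarith) (sq_nonneg _)
    refine sq_le_sq' ?_ ?_ <;> rw [hMω] <;>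
      linarith [abs_le.1 h2, abs_le.1 hωc, (abs_le.1 h2).1, (abs_le.1 h2).2, (abs_le.1 hωc).1,
        (abs_le.1 hωc).2]
  have hθe : ∀ z ∈ Icc 0 τ, ∀ x ∈ Icc 0 τ, √((s.θHat z - θ x) ⬝ᵥ (s.θHat z - θ x)) ≤ Mθ :=
    fun z hz x hx => sqrt_dotProduct_sub_le hε.le hRθ
      (dotProduct_self_le_of_vecProj_ode hε hRθ' hΓθ h.θHat_zero h.θHat_ode hz) (hθθ x hx)
  have hσe : ∀ z ∈ Icc 0 τ, ∀ x ∈ Icc 0 τ, √((s.σHat z - σ x) ⬝ᵥ (s.σHat z - σ x)) ≤ Mσ :=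
    fun z hz x hx => sqrt_dotProduct_sub_le hε.le hRσ
      (dotProduct_self_le_of_vecProj_ode hε hRσ' hΓσ h.σHat_zero h.σHat_ode hz) (hσσ x hx)
  have hθe2 : ∀ z ∈ Icc 0 τ, (s.θHat z - θ z) ⬝ᵥ (s.θHat z - θ z) ≤ Mθ ^ 2 := fun z hz =>
    (Real.sqrt_le_left hMθ0).1 (hθe z hz z hz)
  have hσe2 : ∀ z ∈ Icc 0 τ, (s.σHat z - σ z) ⬝ᵥ (s.σHat z - σ z) ≤ Mσ ^ 2 := fun z hz =>
    (Real.sqrt_le_left hMσ0).1 (hσe z hz z hz)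
  have hdiv : ∀ {a b c : ℝ}, 0 ≤ b → a ≤ b → K.Γ ≤ c → a / c ≤ b / K.Γ := fun hb hab hc =>
    div_le_div₀ hb hab hΓ hc
  have hparam : ∀ z ∈ Icc 0 τ, S.lam₁ * ((s.ωHat z - W.ω) ^ 2 / K.Γω +
      (s.θHat z - θ z) ⬝ᵥ (s.θHat z - θ z) / K.Γθ +
      (s.σHat z - σ z) ⬝ᵥ (s.σHat z - σ z) / K.Γσ) + 2 * Mθ * Lθ / K.Γθ + 2 * Mσ * Lσ / K.Γσ ≤
      S.lam₁ * (S.θ₁ lθ lσ / K.Γ) := by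
    intro z hz
    have h1 := hdiv (sq_nonneg Mω) (hωe z hz) K.Γ_le_Γω
    have h2 := hdiv (sq_nonneg Mθ) (hθe2 z hz) K.Γ_le_Γθ
    have h3 := hdiv (sq_nonneg Mσ) (hσe2 z hz) K.Γ_le_Γσ
    have h4 : 2 * Mθ * Lθ / K.Γθ ≤ 2 * Mθ * Lθ / K.Γ :=
      hdiv (by positivity) le_rfl K.Γ_le_Γθ
    have h5 : 2 * Mσ * Lσ / K.Γσ ≤ 2 * Mσ * Lσ / K.Γ :=
      hdiv (by positivity) le_rfl K.Γ_le_Γσ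
    have h6 := mul_le_mul_of_nonneg_left (add_le_add (add_le_add h1 h2) h3) hlam.le
    have h7 := mul_le_mul_of_nonneg_left (div_le_div_of_nonneg_right htol hΓ.le) hlam.le
    have h8 : S.lam₁ * ((Mω ^ 2 + Mθ ^ 2 + Mσ ^ 2 +
        2 / S.lam₁ * (Mθ * Lθ + Mσ * Lσ)) / K.Γ) =
        S.lam₁ * (Mω ^ 2 / K.Γ + Mθ ^ 2 / K.Γ + Mσ ^ 2 / K.Γ) + 2 * Mθ * Lθ / K.Γ +
          2 * Mσ * Lσ / K.Γ := by
      field_simp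
      ring
    linarith
  have hθc := continuousOn_of_norm_sub_le hlθ fun t ht t' ht' => (hlip t ht t' ht').1
  have hσc := continuousOn_of_norm_sub_le hlσ fun t ht t' ht' => (hlip t ht t' ht').2
  have hθd : ∀ x ∈ Icc 0 τ, ∀ z ∈ Icc x τ, √((θ x - θ z) ⬝ᵥ (θ x - θ z)) ≤ Lθ * (z - x) := by
    intro x hx z hz
    refine (sqrt_dotProduct_self_le_sqrt_mul_norm _).trans ?_
    have := (hlip x hx z ⟨hx.1.trans hz.1, hz.2⟩).1
    rw [abs_sub_comm, abs_of_nonneg (sub_nonneg.2 hz.1)] at this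
    rw [hLθ, mul_assoc]
    exact mul_le_mul_of_nonneg_left this (Real.sqrt_nonneg _)
  have hσd : ∀ x ∈ Icc 0 τ, ∀ z ∈ Icc x τ, √((σ x - σ z) ⬝ᵥ (σ x - σ z)) ≤ Lσ * (z - x) := by
    intro x hx z hz
    refine (sqrt_dotProduct_self_le_sqrt_mul_norm _).trans ?_
    have := (hlip x hx z ⟨hx.1.trans hz.1, hz.2⟩).2
    rw [abs_sub_comm, abs_of_nonneg (sub_nonneg.2 hz.1)] at this
    rw [hLσ, mul_assoc]
    exact mul_le_mul_of_nonneg_left this (Real.sqrt_nonneg _)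
  have hed := fun x hx => hasDerivWithinAt_quadraticForm hS.transpose_Pv
    (hasDerivWithinAt_stateError hS hW h hv (t := x) hx)
  have hyd := fun x hx => hasDerivWithinAt_quadraticForm hS.transpose_Py
    (hasDerivWithinAt_yTilde hS hW h hv (t := x) hx (hf x hx))
  have hωd := fun x hx => ((h.ωHat_ode x hx).sub_const W.ω).fun_pow 2
  have hVc : ContinuousOn (lyapunovFn s S W K xv θ σ) (Icc 0 τ) := by
    have c1 : ContinuousOn (fun t => (s.θHat t - θ t) ⬝ᵥ (s.θHat t - θ t)) (Icc 0 τ) := by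
      have : ContinuousOn (fun t => s.θHat t - θ t) (Icc 0 τ) :=
        ContinuousOn.sub (fun t ht => (h.θHat_ode t ht).continuousWithinAt) hθc
      exact (continuous_id.dotProduct continuous_id).comp_continuousOn this
    have c2 : ContinuousOn (fun t => (s.σHat t - σ t) ⬝ᵥ (s.σHat t - σ t)) (Icc 0 τ) := by
      have : ContinuousOn (fun t => s.σHat t - σ t) (Icc 0 τ) :=
        ContinuousOn.sub (fun t ht => (h.σHat_ode t ht).continuousWithinAt) hσc
      exact (continuous_id.dotProduct continuous_id).comp_continuousOn this
    exact ((((ContinuousOn.add (fun x hx => (hed x hx).continuousWithinAt)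
      (fun x hx => (hyd x hx).continuousWithinAt)).add
      (ContinuousOn.div_const (fun x hx => (hωd x hx).continuousWithinAt) _)).add
      (c1.div_const _)).add (c2.div_const _))
  have hmain := le_exp_of_upper_comparison (V := lyapunovFn s S W K xv θ σ) (lam := S.lam₁)
    (c := S.θ₁ lθ lσ / K.Γ) hVc ?_ ht
  · refine hmain.trans (add_le_add_right (mul_le_mul_of_nonneg_right ?_ (Real.exp_nonneg _)) _)
    have h0 : (0 : ℝ) ∈ Icc 0 τ := ⟨le_rfl, ht.1.trans ht.2⟩
    have hy0 : s.yTilde S 0 = 0 := by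
      rw [Signals.yTilde, Signals.y, h.yHat_zero, h.x_zero, sub_self]
    have he0 : s.xvHat S 0 - xv 0 = -((1 - S.H * S.Cm) *ᵥ W.x₀) := by
      rw [Signals.xvHat, Signals.y, h.vHat_zero, h.x_zero, hv.xv_zero, sub_mulVec, one_mulVec,
        mulVec_mulVec]
      abel
    have hE0 : (s.xvHat S 0 - xv 0) ⬝ᵥ (S.Pv *ᵥ (s.xvHat S 0 - xv 0)) =
        W.x₀ ⬝ᵥ (S.PvBar *ᵥ W.x₀) := by
      rw [he0, mulVec_neg, neg_dotProduct_neg, Design.PvBar, ← mulVec_mulVec, ← mulVec_mulVec,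
        dotProduct_comm W.x₀, transpose_mulVec_dotProduct, dotProduct_comm]
    have hPvBar : S.PvBar.PosSemidef := by
      have := hS.Pv_pos.posSemidef.conjTranspose_mul_mul_same (1 - S.H * S.Cm)
      rwa [conjTranspose_eq_transpose_of_trivial] at this
    have h1 : W.x₀ ⬝ᵥ (S.PvBar *ᵥ W.x₀) ≤ n * lambdaMax S.PvBar * ‖W.x₀‖ ^ 2 := by
      refine (dotProduct_le_lambdaMax_mul hPvBar.isHermitian W.x₀).trans ?_
      refine (mul_le_mul_of_nonneg_left (dotProduct_self_le_card_mul_norm_sq W.x₀)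
        (lambdaMax_nonneg hPvBar)).trans (le_of_eq (by ring))
    have h2 := hparam 0 h0
    have h3 : 0 ≤ 2 * Mθ * Lθ / K.Γθ + 2 * Mσ * Lσ / K.Γσ := by positivity
    have h4 := le_of_mul_le_mul_left ((le_add_of_nonneg_right h3).trans
      ((add_assoc _ _ _).symm.le.trans h2)) hlam
    rw [lyapunovFn, hE0, hy0, zero_dotProduct]
    linarith
  · intro x hx
    have hx' := Ico_subset_Icc_self hx
    refine ⟨_, _, ((((hed x hx').fun_add (hyd x hx')).fun_add ((hωd x hx').div_const K.Γω)).fun_add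
      ((hasDerivWithinAt_majorant (θ := θ x) (M := Mθ) (L := Lθ)
        (h.θHat_ode x hx')).div_const K.Γθ)).fun_add
      ((hasDerivWithinAt_majorant (θ := σ x) (M := Mσ) (L := Lσ)
        (h.σHat_ode x hx')).div_const K.Γσ), ?_, ?_, ?_⟩
    · simp [lyapunovFn]
    · intro z hz
      have hz' : z ∈ Icc 0 τ := ⟨hx.1.trans hz.1, hz.2⟩
      have h1 := div_le_div_of_nonneg_right
        (dotProduct_sub_self_le (hθe z hz' x hx') (hθd x hx' z hz)) hΓθ.le
      have h2 := div_le_div_of_nonneg_right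
        (dotProduct_sub_self_le (hσe z hz' x hx') (hσd x hx' z hz)) hΓσ.le
      rw [lyapunovFn]
      linarith
    · have hE := hS.energy_rate_le (e := s.xvHat S x - xv x) (yt := s.yTilde S x)
        (w := paramError s S W θ σ x) (θ := θ x) (δ := ‖s.xgHat S x‖ - ‖s.xg xv x‖)
        (hbd x hx').1 ((abs_norm_sub_norm_le _ _).trans (by
          have := norm_sum_elim_sub_le (s.xvHat S x) (xv x) (s.xu x) (s.xu x)
          rw [sub_self, norm_zero, add_zero] at this
          exact this))
      have hp := hparam x hx'
      have e1 := inner_sub_smoothProj_sub_nonpos hε hr.le (θ := s.ωHat x)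
        (-(s.uz S x ⬝ᵥ s.ey S x)) (by rwa [Real.norm_eq_abs])
      have e2 := dotProduct_vecProj_sub_nonpos hε hRθ (θ := s.θHat x)
        (-(‖s.xgHat S x‖ • s.ey S x)) (hθθ x hx')
      have e3 := dotProduct_vecProj_sub_nonpos hε hRσ (θ := s.σHat x)
        (-(s.ey S x)) (hσσ x hx')
      rw [real_inner_eq_re_inner, RCLike.inner_apply] at e1
      simp only [conj_trivial, RCLike.re_to_real] at e1
      rw [dotProduct_sub, dotProduct_neg, dotProduct_smul, smul_eq_mul] at e2
      rw [dotProduct_sub, dotProduct_neg] at e3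
      have e4 : ((S.Bbarᵀ * S.Cmᵀ * S.Py) *ᵥ s.yTilde S x) ⬝ᵥ paramError s S W θ σ x =
          (s.ωHat x - W.ω) * (s.uz S x ⬝ᵥ s.ey S x) +
            ‖s.xgHat S x‖ * ((s.θHat x - θ x) ⬝ᵥ s.ey S x) + (s.σHat x - σ x) ⬝ᵥ s.ey S x := by
        change s.ey S x ⬝ᵥ _ = _
        rw [dotProduct_comm, paramError, add_dotProduct, add_dotProduct, smul_dotProduct,
          smul_dotProduct, smul_eq_mul, smul_eq_mul]
      rw [e4] at hE
      have f1 : ∀ {a b c : ℝ}, 0 < c → ((2 : ℕ) : ℝ) * a ^ (2 - 1) * (c * b) / c = 2 * (b * a) := by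
        intro a b c hc
        field_simp
        norm_num
        ring
      have f2 : ∀ {a b c : ℝ}, 0 < c → (2 * (c * a) + b) / c = 2 * a + b / c := by
        intro a b c hc
        field_simp
      rw [dotProduct_smul, dotProduct_smul, smul_eq_mul, smul_eq_mul, f1 hΓω, f2 hΓθ, f2 hΓσ]
      rw [lyapunovFn]
      linarith

/-- From the Lyapunov bound to the bound on the output-estimation error. -/
theorem norm_yTilde_le {W : Unknowns n m} {K : Controller m mr nd} {s : Signals n m p nz nd}
    {lθ lσ : ℝ} (hS : S.Admissible) (hK : K.Admissible S) (hθ₁ : 0 ≤ S.θ₁ lθ lσ)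
    {xv : ℝ → Fin n → ℝ} {θ σ : ℝ → Fin m → ℝ} {t : ℝ}
    (hV : lyapunovFn s S W K xv θ σ t ≤ S.θ₁ lθ lσ / K.Γ +
      n * lambdaMax S.PvBar * ‖W.x₀‖ ^ 2 * Real.exp (-S.lam₁ * t)) :
    ‖s.yTilde S t‖ ≤ S.κy * Real.exp (-(S.lam₁ / 2) * t) * ‖W.x₀‖ +
      √(S.θ₁ lθ lσ / lambdaMin S.Py) * (1 / √K.Γ) := by
  rcases Nat.eq_zero_or_pos p with rfl | hp
  · rw [Subsingleton.elim (s.yTilde S t) 0, norm_zero]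
    exact add_nonneg (mul_nonneg (mul_nonneg (Real.sqrt_nonneg _) (Real.exp_nonneg _))
      (norm_nonneg _)) (by positivity)
  have hΓ := hK.Γ_pos
  have hmin := lambdaMin_pos hp hS.Py_pos
  have h1 : lambdaMin S.Py * ‖s.yTilde S t‖ ^ 2 ≤ lyapunovFn s S W K xv θ σ t := by
    have g1 := mul_le_mul_of_nonneg_left (norm_sq_le_dotProduct_self (s.yTilde S t)) hmin.le
    have g2 := lambdaMin_mul_dotProduct_le hS.Py_pos.isHermitian (s.yTilde S t)
    have g3 := hS.Pv_pos.posSemidef.dotProduct_mulVec_nonneg (s.xvHat S t - xv t)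
    rw [star_trivial] at g3
    have g4 : 0 ≤ (s.ωHat t - W.ω) ^ 2 / K.Γω := div_nonneg (sq_nonneg _) hK.Γω_pos.le
    have g5 : 0 ≤ (s.θHat t - θ t) ⬝ᵥ (s.θHat t - θ t) / K.Γθ :=
      div_nonneg (zero_le_dotProduct_self _) hK.Γθ_pos.le
    have g6 : 0 ≤ (s.σHat t - σ t) ⬝ᵥ (s.σHat t - σ t) / K.Γσ :=
      div_nonneg (zero_le_dotProduct_self _) hK.Γσ_pos.le
    rw [lyapunovFn]
    linarith
  have hPvBar : S.PvBar.PosSemidef := by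
    have := hS.Pv_pos.posSemidef.conjTranspose_mul_mul_same (1 - S.H * S.Cm)
    rwa [conjTranspose_eq_transpose_of_trivial] at this
  have hmax := lambdaMax_nonneg hPvBar
  set a := S.κy * Real.exp (-(S.lam₁ / 2) * t) * ‖W.x₀‖ with ha
  set b := √(S.θ₁ lθ lσ / lambdaMin S.Py) * (1 / √K.Γ) with hb
  have ha0 : 0 ≤ a := mul_nonneg (mul_nonneg (Real.sqrt_nonneg _) (Real.exp_nonneg _))
    (norm_nonneg _)
  have hb0 : 0 ≤ b := by positivity
  have ha2 : a ^ 2 = n * lambdaMax S.PvBar * ‖W.x₀‖ ^ 2 * Real.exp (-S.lam₁ * t) /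
      lambdaMin S.Py := by
    have e : Real.exp (-(S.lam₁ / 2) * t) ^ 2 = Real.exp (-S.lam₁ * t) := by
      rw [← Real.exp_nat_mul]; congr 1; push_cast; ring
    rw [ha, mul_pow, mul_pow, e, Design.κy, Real.sq_sqrt (by positivity)]
    ring
  have hb2 : b ^ 2 = S.θ₁ lθ lσ / K.Γ / lambdaMin S.Py := by
    rw [hb, mul_pow, div_pow, Real.sq_sqrt (by positivity), Real.sq_sqrt hΓ.le]
    field_simp
  refine (pow_le_pow_iff_left₀ (norm_nonneg _) (add_nonneg ha0 hb0) two_ne_zero).1 ?_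
  have h2 : ‖s.yTilde S t‖ ^ 2 ≤ a ^ 2 + b ^ 2 := by
    rw [ha2, hb2, ← add_div, le_div_iff₀ hmin]
    linarith
  nlinarith [mul_nonneg ha0 hb0]

end Lyapunov

end L1Adaptive

/-- First part: rate bounds `lθ`, `lσ` for the parametrization of the lumped uncertainty exist and
depend on the design data only. Second part: with any such rate bounds, the output-estimation
error obeys the claimed bound, provided the tolerance of the projection operators is small
enough; how small does not depend on the unknowns, the adaptation gains, the rest of the
controller or `τ`. -/
theorem lemma5 {n m p nz : ℕ} (S : L1Adaptive.Design n m p nz) (hS : S.Admissible) :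
    (∃ lθ ≥ 0, ∃ lσ ≥ 0,
      ∀ (mr nd : ℕ) (W : L1Adaptive.Unknowns n m) (K : L1Adaptive.Controller m mr nd)
        (s : L1Adaptive.Signals n m p nz nd) (τ : ℝ),
        W.Admissible S → K.Admissible S → 0 < τ → s.IsClosedLoop S W K τ → s.Bounded S τ →
        s.Parametrized S W τ lθ lσ) ∧
    (∀ lθ ≥ 0, ∀ lσ ≥ 0, ∃ ε₀ > 0,
      ∀ (mr nd : ℕ) (W : L1Adaptive.Unknowns n m) (K : L1Adaptive.Controller m mr nd)
        (s : L1Adaptive.Signals n m p nz nd) (τ : ℝ),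
        W.Admissible S → K.Admissible S → K.ε ≤ ε₀ → 0 < τ → s.IsClosedLoop S W K τ →
        s.Bounded S τ → s.Parametrized S W τ lθ lσ →
        ∀ t ∈ Set.Icc 0 τ,
          ‖s.yTilde S t‖ ≤ S.κy * Real.exp (-(S.lam₁ / 2) * t) * ‖W.x₀‖ +
            √(S.θ₁ lθ lσ / L1Adaptive.lambdaMin S.Py) * (1 / √K.Γ)) := by
  have hd := hS.dBar_nonneg
  have hb := hS.bBar_nonneg
  have hf := hS.fBarRate_nonneg
  have hg := hS.xgRate_nonneg
  refine ⟨⟨_, ?_, _, ?_, fun mr nd W K s τ hW _ hτ h hbd =>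
    L1Adaptive.exists_rate_bounds hS hW hτ h hbd⟩, fun lθ hlθ lσ hlσ => ?_⟩
  · change 0 ≤ _
    positivity
  · change 0 ≤ _
    positivity
  · obtain ⟨ε₀, hε₀, htol⟩ := hS.exists_tolerance hlθ hlσ
    refine ⟨ε₀, hε₀, ?_⟩
    rintro mr nd W K s τ hW hK hε hτ h - ⟨xv, xf, θ, σ, hv, hfb, hbd, hlip⟩ t ht
    have hθ₁ : 0 ≤ S.θ₁ lθ lσ := by
      have := hS.lam₁_pos
      have : (0 : ℝ) ≤ lθ := hlθ
      have : (0 : ℝ) ≤ lσ := hlσ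
      rw [L1Adaptive.Design.θ₁, L1Adaptive.Design.θ₀]
      positivity
    exact L1Adaptive.norm_yTilde_le hS hK hθ₁ (L1Adaptive.lyapunovFn_le hS hW hK h hlθ hlσ
      (htol K.ε hK.ε_pos hε) hv hfb hbd hlip ht)
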